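/- **Theorem.** Let $\mathbb Z^+=\{0,1,2,\dots\}$. A probability on $\mathbb Z^+$ is a function $F\ge 0$ on $\mathbb Z$, vanishing outside $\mathbb Z^+$, with $\sum_k F(k)=1$; write $F^{(n)}=F*\cdots*F$ for its $n$-th convolution power and $\|G\|_{L^1(\mathbb Z)}=\sum_{k\in\mathbb Z}|G(k)|$. Let $\mathcal A$ be the set of all probabilities $F$ on $\mathbb Z^+$ such that $$\sup_{n\ge 1}\, n\,\|F^{(n)}-F^{(n+1)}\|_{L^1(\mathbb Z)}<\infty .$$ A bounded linear operator $T$ on a complex Banach space $X$ is power-bounded if $\sup_{n\ge1}\|T^n\|<\infty$, and a Ritt operator if in addition $\sup_{n\ge1} n\|T^n-T^{n+1}\|<\infty$. For a probability $F$ on $\mathbb Z^+$ and $T$ power-bounded, put $\Psi(F;T)=\sum_{k\ge0}F(k)T^k$. For $\alpha\in(0,1)$ let $Z_\alpha$ be given by $Z_\alpha(k)=\zeta(1+\alpha)^{-1}k^{-1-\alpha}$ for $k\ge1$ and $Z_\alpha(k)=0$ for $k\le 0$, where $\zeta(s)=\sum_{n\ge1}n^{-s}$. Then $Z_\alpha\in\mathcal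 A$. Moreover, for every complex Banach space $X$ and every power-bounded bounded linear operator $T$ on $X$, the series $\Psi(Z_\alpha;T)=\sum_{k\ge 0}Z_\alpha(k)T^k$ converges absolutely in operator norm and $\Psi(Z_\alpha;T)$ is a Ritt operator. -/

import Mathlib

open scoped ENNReal ComplexOrder

noncomputable section

namespace RittProb

/-- The norm `‖F‖ = ∑_{k ∈ ℤ} |F k|` of `L¹(ℤ)`, with values in `[0, ∞]`. -/
def l1Norm (F : ℤ → ℂ) : ℝ≥0∞ := ∑' k : ℤ, ‖F k‖ₑ

/-- The space `L¹(ℤ)` of absolutely summable complex functions on `ℤ`. -/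
def L1Z : Set (ℤ → ℂ) := {F | l1Norm F < ∞}

/-- The subalgebra `L¹(ℤ⁺)` of those `F ∈ L¹(ℤ)` that are supported in `{0, 1, 2, …}`. -/
def L1Zplus : Set (ℤ → ℂ) := {F | F ∈ L1Z ∧ ∀ k : ℤ, F k ≠ 0 → 0 ≤ k}

/-- The convolution product `(F * G)(m) = ∑_{k ∈ ℤ} F(k) G(m - k)`. -/
def conv (F G : ℤ → ℂ) : ℤ → ℂ := fun m => ∑' k : ℤ, F k * G (m - k)

/-- The point mass `δ_m`. -/
def delta (m : ℤ) : ℤ → ℂ := Pi.single m 1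

/-- The convolution power `F⁽ⁿ⁾ = F * ⋯ * F` (`n` factors), with `F⁽⁰⁾ = δ_0`. -/
def convPow (F : ℤ → ℂ) : ℕ → ℤ → ℂ
  | 0 => delta 0
  | n + 1 => conv F (convPow F n)

/-- The probabilities on `ℤ`: the `F ∈ L¹(ℤ)` with `F ≥ 0` and `∑ F = 1`
(`0 ≤ F k` for a complex number `F k` says that it is real and nonnegative). -/
def ProbZ : Set (ℤ → ℂ) := {F | F ∈ L1Z ∧ (∀ k, 0 ≤ F k) ∧ HasSum F 1}

/-- The probabilities on `ℤ⁺ = {0, 1, 2, …}`. -/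
def ProbZplus : Set (ℤ → ℂ) := ProbZ ∩ L1Zplus

/-- The class `𝒜` of probabilities `F` on `ℤ⁺` with
`sup_{n ≥ 1} n ‖F⁽ⁿ⁾ - F⁽ⁿ⁺¹⁾‖ < ∞`, the norm being that of `L¹(ℤ)`. -/
def classA : Set (ℤ → ℂ) :=
  {F | F ∈ ProbZplus ∧
    (⨆ (n : ℕ) (_ : 1 ≤ n), (n : ℝ≥0∞) * l1Norm (convPow F n - convPow F (n + 1))) < ∞}

/-- The zeta probability: `Z_α(k) = ζ(1+α)⁻¹ k^{-1-α}` for `k ≥ 1`, and `0` for `k ≤ 0`. -/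
def zetaProb (α : ℝ) : ℤ → ℂ := fun k =>
  if 1 ≤ k then (riemannZeta (1 + (α : ℂ)))⁻¹ * (((k : ℝ) ^ (-1 - α) : ℝ) : ℂ) else 0

section Operators

variable {X : Type*} [NormedAddCommGroup X] [NormedSpace ℂ X]

/-- `T` is power-bounded: `sup_{n ≥ 1} ‖Tⁿ‖ < ∞`. -/
def IsPowerBounded (T : X →L[ℂ] X) : Prop := ∃ C : ℝ, ∀ n : ℕ, 1 ≤ n → ‖T ^ n‖ ≤ C

/-- `S` is a Ritt operator: it is power-bounded and `sup_{n ≥ 1} n ‖Sⁿ - Sⁿ⁺¹‖ < ∞`. -/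
def IsRitt (S : X →L[ℂ] X) : Prop :=
  IsPowerBounded S ∧ ∃ C : ℝ, ∀ n : ℕ, 1 ≤ n → (n : ℝ) * ‖S ^ n - S ^ (n + 1)‖ ≤ C

/-- `Ψ(F; T) = ∑_{k ≥ 0} F(k) T^k`, a series in the Banach space of bounded operators
(absolutely convergent if `T` is power-bounded and `F ∈ L¹(ℤ⁺)`). -/
def Psi (F : ℤ → ℂ) (T : X →L[ℂ] X) : X →L[ℂ] X := ∑' k : ℕ, F (k : ℤ) • T ^ k

end Operators

end RittProb

end

/-! The map F ↦ Ψ(F;T) is multiplicative and bounded by sup ‖T^k‖ times the L¹ norm, so the operator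
statement follows from Z_α ∈ 𝒜. With f the generating function of Z_α, what has to be shown is that
the coefficients of f^n (1 - f) have absolute sum O(1/n).

A Bose integral gives Γ(1+α) ζ(1+α) (1 - f(z)) = ∫_0^∞ log(1+y)^α w / (y (y+w)) dy with w = 1 - z
(`boseConst_mul_one_sub_genFun`). The right side continues f to the plane slit along [1, ∞). Near z
= 1 both |1 - f| and Re(1 - f) are of order |w|^α, even in a sector slightly wider than Re w ≥ 0.
Together with |f| < 1 on the unit circle away from 1, this yields |f| ≤ e^{-cθ^α} and |1 - f| ≤ Cθ^α
on spirals z = e^{(ε+i)θ}, 0 < θ ≤ π, which run outside the unit disc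
(`exists_zetaGen_spiral_bounds`).

The coefficients of f^n (1 - f) are real, so an integral over a half circle recovers them. In the
variable s = log z the segment from 0 to iπ is rotated to the ray of direction ε + i. The connecting
segment lies on Im s = π, where the integrand is real, so the imaginary part does not see it
(`im_integral_ray_eq`). The gain is a factor e^{-kεθ}: summation over k ≥ 1 costs at most 1/(εθ),
and n ∫ θ^{α-1} e^{-ncθ^α} dθ ≤ 1/(cα). The coefficient at k = 0 vanishes. -/

namespace RittProb

/-! ### The convolution algebra L¹(ℤ⁺). -/

lemma eq_zero_of_neg {F : ℤ → ℂ} (hF : F ∈ L1Zplus) {k : ℤ} (hk : k < 0) : F k = 0 := by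
  by_contra h
  exact absurd (hF.2 k h) (not_le.mpr hk)

lemma support_subset_range_natCast {E : Type*} [Zero E] {f : ℤ → E} (h : ∀ k < 0, f k = 0) :
    Function.support f ⊆ Set.range ((↑) : ℕ → ℤ) := by
  intro k hk
  have : 0 ≤ k := by
    by_contra h'
    exact hk (h k (not_le.mp h'))
  exact ⟨k.toNat, Int.toNat_of_nonneg this⟩

lemma tsum_eq_tsum_natCast {E : Type*} [AddCommMonoid E] [TopologicalSpace E] {f : ℤ → E}
    (h : ∀ k < 0, f k = 0) : ∑' k : ℤ, f k = ∑' k : ℕ, f k :=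
  (Function.Injective.tsum_eq Nat.cast_injective (support_subset_range_natCast h)).symm

lemma l1Norm_eq_tsum_natCast {F : ℤ → ℂ} (hF : F ∈ L1Zplus) :
    l1Norm F = ∑' k : ℕ, ‖F k‖ₑ :=
  tsum_eq_tsum_natCast fun k hk => by simp [eq_zero_of_neg hF hk]

lemma summable_norm {F : ℤ → ℂ} (hF : F ∈ L1Z) : Summable fun k => ‖F k‖ := by
  have h : ∑' k : ℤ, ((‖F k‖₊ : NNReal) : ℝ≥0∞) ≠ ∞ := ne_of_lt hF
  exact NNReal.summable_coe.mpr (ENNReal.tsum_coe_ne_top_iff_summable.mp h)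

lemma summable_norm_natCast {F : ℤ → ℂ} (hF : F ∈ L1Z) : Summable fun k : ℕ => ‖F k‖ :=
  (summable_norm hF).comp_injective Nat.cast_injective

lemma l1Norm_conv_le (F G : ℤ → ℂ) : l1Norm (conv F G) ≤ l1Norm F * l1Norm G := by
  calc l1Norm (conv F G) ≤ ∑' m : ℤ, ∑' k : ℤ, ‖F k‖ₑ * ‖G (m - k)‖ₑ := by
        refine ENNReal.tsum_le_tsum fun m => ?_
        refine enorm_tsum_le_tsum_enorm.trans (le_of_eq ?_)
        simp
    _ = ∑' k : ℤ, ‖F k‖ₑ * ∑' m : ℤ, ‖G (m - k)‖ₑ := by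
        rw [ENNReal.tsum_comm]
        simp_rw [ENNReal.tsum_mul_left]
    _ = ∑' k : ℤ, ‖F k‖ₑ * l1Norm G := by
        congr 1; ext k; congr 1
        exact (Equiv.subRight k).tsum_eq fun m => ‖G m‖ₑ
    _ = l1Norm F * l1Norm G := ENNReal.tsum_mul_right

lemma conv_apply_of_neg {F G : ℤ → ℂ} (hF : F ∈ L1Zplus) (hG : G ∈ L1Zplus) {m : ℤ}
    (hm : m < 0) : conv F G m = 0 := by
  refine (tsum_congr fun k => ?_).trans tsum_zero
  rcases lt_or_ge k 0 with hk | hk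
  · rw [eq_zero_of_neg hF hk, zero_mul]
  · rw [eq_zero_of_neg hG (by linarith), mul_zero]

lemma conv_natCast {F G : ℤ → ℂ} (hF : F ∈ L1Zplus) (hG : G ∈ L1Zplus) (n : ℕ) :
    conv F G n = ∑ p ∈ Finset.HasAntidiagonal.antidiagonal n, F (p.1 : ℤ) * G (p.2 : ℤ) := by
  rw [conv, tsum_eq_tsum_natCast fun k hk => by rw [eq_zero_of_neg hF hk, zero_mul],
    tsum_eq_sum (s := Finset.range (n + 1)),
    Finset.Nat.sum_antidiagonal_eq_sum_range_succ fun i j : ℕ => F (i : ℤ) * G (j : ℤ)]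
  · refine Finset.sum_congr rfl fun k hk => ?_
    rw [Nat.cast_sub (Nat.lt_succ_iff.mp (Finset.mem_range.mp hk))]
  · intro k hk
    rw [Finset.mem_range, not_lt] at hk
    rw [eq_zero_of_neg hG (by omega), mul_zero]

lemma conv_mem {F G : ℤ → ℂ} (hF : F ∈ L1Zplus) (hG : G ∈ L1Zplus) : conv F G ∈ L1Zplus := by
  refine ⟨(l1Norm_conv_le F G).trans_lt (ENNReal.mul_lt_top hF.1 hG.1), fun k hk => ?_⟩
  by_contra h
  exact hk (conv_apply_of_neg hF hG (not_le.mp h))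

lemma l1Norm_delta (m : ℤ) : l1Norm (delta m) = 1 := by
  rw [l1Norm, tsum_eq_single m fun k hk => by simp [delta, hk]]
  simp [delta]

lemma convPow_mem {F : ℤ → ℂ} (hF : F ∈ L1Zplus) (n : ℕ) : convPow F n ∈ L1Zplus := by
  induction n with
  | zero =>
    refine ⟨?_, fun k hk => ?_⟩
    · change l1Norm (delta 0) < ∞
      simp [l1Norm_delta]
    · by_contra h
      exact hk (by simp [convPow, delta, (show k ≠ 0 by omega)])
  | succ n ih => exact conv_mem hF ih

lemma sub_mem {F G : ℤ → ℂ} (hF : F ∈ L1Zplus) (hG : G ∈ L1Zplus) : F - G ∈ L1Zplus := by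
  refine ⟨?_, fun k hk => ?_⟩
  · calc l1Norm (F - G) ≤ ∑' k, (‖F k‖ₑ + ‖G k‖ₑ) :=
        ENNReal.tsum_le_tsum fun k => enorm_sub_le
      _ = l1Norm F + l1Norm G := ENNReal.tsum_add
      _ < ∞ := ENNReal.add_lt_top.mpr ⟨hF.1, hG.1⟩
  · by_contra h
    exact hk (by simp [eq_zero_of_neg hF (not_le.mp h), eq_zero_of_neg hG (not_le.mp h)])

lemma l1Norm_convPow_le {F : ℤ → ℂ} (hF : l1Norm F ≤ 1) (n : ℕ) : l1Norm (convPow F n) ≤ 1 := by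
  induction n with
  | zero => exact (l1Norm_delta 0).le
  | succ n ih => exact (l1Norm_conv_le _ _).trans (mul_le_one' hF ih)

/-- Disposes of the coefficient k = 0, the only one to which the contour rotation brings no decay.
-/
lemma convPow_apply_zero {F : ℤ → ℂ} (hF : F ∈ L1Zplus) (h0 : F 0 = 0) {n : ℕ} (hn : 1 ≤ n) :
    convPow F n 0 = 0 := by
  obtain ⟨n, rfl⟩ := Nat.exists_eq_add_of_le' hn
  have := conv_natCast hF (convPow_mem hF n) 0
  simpa [h0, convPow] using this

/-- Real coefficients are what allows a half circle to replace the full circle in Cauchy's formula.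
-/
lemma convPow_im {F : ℤ → ℂ} (hF : ∀ k, (F k).im = 0) (n : ℕ) (k : ℤ) :
    (convPow F n k).im = 0 := by
  simp_rw [← Complex.conj_eq_iff_im] at hF ⊢
  induction n generalizing k with
  | zero =>
    rcases eq_or_ne k 0 with rfl | hk
    · simp [convPow, delta]
    · simp [convPow, delta, hk]
  | succ n ih =>
    change (starRingEnd ℂ) (∑' j, _) = ∑' j, _
    rw [Complex.conj_tsum]
    exact tsum_congr fun j => by rw [map_mul, hF, ih]

/-! ### Generating functions at elements with bounded powers. -/

section GenFun

variable {A : Type*} [NormedRing A] [NormedAlgebra ℂ A]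

/-- The generating function `∑ₖ F(k) aᵏ` of `F` at an element `a` of a normed algebra. -/
noncomputable def genFun (F : ℤ → ℂ) (a : A) : A := ∑' k : ℕ, F (k : ℤ) • a ^ k

lemma norm_genFun_term_le {a : A} {C : ℝ} (ha : ∀ k, ‖a ^ k‖ ≤ C) (F : ℤ → ℂ) (k : ℕ) :
    ‖F (k : ℤ) • a ^ k‖ ≤ ‖F k‖ * C :=
  (norm_smul_le _ _).trans (mul_le_mul_of_nonneg_left (ha k) (norm_nonneg _))

lemma summable_norm_genFun {F : ℤ → ℂ} (hF : F ∈ L1Z) {a : A} {C : ℝ} (ha : ∀ k, ‖a ^ k‖ ≤ C) :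
    Summable fun k : ℕ => ‖F (k : ℤ) • a ^ k‖ :=
  Summable.of_nonneg_of_le (fun _ => norm_nonneg _) (norm_genFun_term_le ha F)
    ((summable_norm_natCast hF).mul_right C)

lemma norm_genFun_le {F : ℤ → ℂ} (hF : F ∈ L1Zplus) {a : A} {C : ℝ} (ha : ∀ k, ‖a ^ k‖ ≤ C) :
    ‖genFun F a‖ ≤ (l1Norm F).toReal * C := by
  have hs := summable_norm_natCast hF.1
  have h : (l1Norm F).toReal = ∑' k : ℕ, ‖F k‖ := by
    rw [l1Norm_eq_tsum_natCast hF, ENNReal.tsum_toReal_eq fun _ => enorm_ne_top]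
    simp
  rw [h, ← tsum_mul_right]
  exact tsum_of_norm_bounded (hs.mul_right C).hasSum (norm_genFun_term_le ha F)

variable [CompleteSpace A]

/-- This is the Cauchy product. The algebra is left general because two cases are needed: complex
numbers of norm at most 1, and power-bounded operators. -/
lemma genFun_conv {F G : ℤ → ℂ} (hF : F ∈ L1Zplus) (hG : G ∈ L1Zplus) {a : A} {C : ℝ}
    (ha : ∀ k, ‖a ^ k‖ ≤ C) : genFun (conv F G) a = genFun F a * genFun G a := by
  rw [genFun, genFun, genFun, tsum_mul_tsum_eq_tsum_sum_antidiagonal_of_summable_norm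
    (summable_norm_genFun hF.1 ha) (summable_norm_genFun hG.1 ha)]
  refine tsum_congr fun n => ?_
  rw [conv_natCast hF hG, Finset.sum_smul]
  refine Finset.sum_congr rfl fun p hp => ?_
  rw [smul_mul_smul_comm, ← pow_add, Finset.HasAntidiagonal.mem_antidiagonal.mp hp]

lemma genFun_convPow {F : ℤ → ℂ} (hF : F ∈ L1Zplus) {a : A} {C : ℝ}
    (ha : ∀ k, ‖a ^ k‖ ≤ C) (n : ℕ) : genFun (convPow F n) a = genFun F a ^ n := by
  induction n with
  | zero =>
    rw [genFun, tsum_eq_single 0 fun k hk => by simp [convPow, delta, hk]]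
    simp [convPow, delta]
  | succ n ih => rw [convPow, genFun_conv hF (convPow_mem hF n) ha, ih, pow_succ']

lemma genFun_sub {F G : ℤ → ℂ} (hF : F ∈ L1Zplus) (hG : G ∈ L1Zplus) {a : A} {C : ℝ}
    (ha : ∀ k, ‖a ^ k‖ ≤ C) : genFun (F - G) a = genFun F a - genFun G a := by
  rw [genFun, genFun, genFun, ← Summable.tsum_sub (summable_norm_genFun hF.1 ha).of_norm
    (summable_norm_genFun hG.1 ha).of_norm]
  exact tsum_congr fun k => by rw [Pi.sub_apply, sub_smul]

end GenFun

/-! ### Transfer from L¹ norms to operators. -/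

section Operators

variable {X : Type*} [NormedAddCommGroup X] [NormedSpace ℂ X]

lemma IsPowerBounded.exists_forall_norm_pow_le {T : X →L[ℂ] X} (hT : IsPowerBounded T) :
    ∃ C : ℝ, ∀ n : ℕ, ‖T ^ n‖ ≤ C := by
  obtain ⟨C, hC⟩ := hT
  -- The definition starts at n = 1; the identity has norm at most 1 (and 0 if X is trivial).
  refine ⟨max C 1, fun n => ?_⟩
  rcases Nat.eq_zero_or_pos n with rfl | hn
  · exact le_max_of_le_right (by rw [pow_zero]; exact ContinuousLinearMap.norm_id_le)
  · exact le_max_of_le_left (hC n hn)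

/-- Members of `𝒜` send power-bounded operators to Ritt operators. -/
lemma isRitt_Psi [CompleteSpace X] {F : ℤ → ℂ} (hF : F ∈ classA) (hF1 : l1Norm F ≤ 1)
    {T : X →L[ℂ] X} (hT : IsPowerBounded T) : IsRitt (Psi F T) := by
  obtain ⟨C, hC⟩ := hT.exists_forall_norm_pow_le
  have hC0 : 0 ≤ C := (norm_nonneg _).trans (hC 0)
  have hFp : F ∈ L1Zplus := hF.1.2
  change IsRitt (genFun F T)
  refine ⟨⟨C, fun n _ => ?_⟩, (⨆ (n : ℕ) (_ : 1 ≤ n),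
      (n : ℝ≥0∞) * l1Norm (convPow F n - convPow F (n + 1))).toReal * C, fun n hn => ?_⟩
  · rw [← genFun_convPow hFp hC]
    refine (norm_genFun_le (convPow_mem hFp n) hC).trans ?_
    refine mul_le_of_le_one_left hC0 (ENNReal.toReal_le_of_le_ofReal zero_le_one ?_)
    simpa using l1Norm_convPow_le hF1 n
  · rw [← genFun_convPow hFp hC, ← genFun_convPow hFp hC,
      ← genFun_sub (convPow_mem hFp n) (convPow_mem hFp (n + 1)) hC]
    refine (mul_le_mul_of_nonneg_left (norm_genFun_le
      (sub_mem (convPow_mem hFp n) (convPow_mem hFp (n + 1))) hC) n.cast_nonneg).trans ?_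
    rw [← mul_assoc]
    refine mul_le_mul_of_nonneg_right ?_ hC0
    have := ENNReal.toReal_mono hF.2.ne (le_iSup₂ (f := fun (n : ℕ) (_ : 1 ≤ n) =>
      (n : ℝ≥0∞) * l1Norm (convPow F n - convPow F (n + 1))) n hn)
    simpa using this

end Operators

/-- The real number `ζ(1 + α)`, as the sum of its Dirichlet series. -/
noncomputable def zetaReal (α : ℝ) : ℝ := ∑' n : ℕ, ((n : ℝ) + 1) ^ (-1 - α)

/-! ### The zeta probability and its generating function on the closed disc. -/

section ZetaProb

variable {α : ℝ}

lemma summable_rpow_neg (hα : 0 < α) : Summable fun n : ℕ => ((n : ℝ) + 1) ^ (-1 - α) := by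
  have := (summable_nat_add_iff 1).mpr (Real.summable_nat_rpow.mpr (show -1 - α < -1 by linarith))
  simpa using this

lemma zetaReal_pos (hα : 0 < α) : 0 < zetaReal α :=
  (summable_rpow_neg hα).tsum_pos (fun n => by positivity) 0 (by positivity)

lemma riemannZeta_eq_zetaReal (hα : 0 < α) : riemannZeta (1 + (α : ℂ)) = zetaReal α := by
  rw [zeta_eq_tsum_one_div_nat_add_one_cpow (by simpa using hα), zetaReal, Complex.ofReal_tsum]
  refine tsum_congr fun n => ?_
  rw [Complex.ofReal_cpow (by positivity), one_div, ← Complex.cpow_neg]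
  push_cast
  ring_nf

lemma zetaProb_natCast_add_one (hα : 0 < α) (n : ℕ) :
    zetaProb α ((n : ℤ) + 1) = (((zetaReal α)⁻¹ * ((n : ℝ) + 1) ^ (-1 - α) : ℝ) : ℂ) := by
  rw [zetaProb, if_pos (by omega), riemannZeta_eq_zetaReal hα]
  push_cast
  rfl

lemma zetaProb_of_le_zero {k : ℤ} (hk : k ≤ 0) : zetaProb α k = 0 := if_neg (by omega)

lemma zetaProb_nonneg (hα : 0 < α) (k : ℤ) : 0 ≤ zetaProb α k := by
  rcases le_or_gt k 0 with hk | hk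
  · rw [zetaProb_of_le_zero hk]
  · obtain ⟨n, rfl⟩ : ∃ n : ℕ, k = n + 1 := ⟨(k - 1).toNat, by omega⟩
    rw [zetaProb_natCast_add_one hα, Complex.zero_le_real]
    have := zetaReal_pos hα
    positivity

lemma zetaProb_im (hα : 0 < α) (k : ℤ) : (zetaProb α k).im = 0 :=
  (Complex.nonneg_iff.mp (zetaProb_nonneg hα k)).2.symm

lemma injective_natCast_add_one : Function.Injective fun n : ℕ => (n : ℤ) + 1 := fun m n h => by
  simpa using h

lemma notMem_range_natCast_add_one {k : ℤ} (hk : k ∉ Set.range fun n : ℕ => (n : ℤ) + 1) :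
    k ≤ 0 := by
  by_contra h
  exact hk ⟨(k - 1).toNat, by change ((k - 1).toNat : ℤ) + 1 = k; omega⟩

lemma hasSum_zetaProb_natCast_add_one (hα : 0 < α) :
    HasSum (fun n : ℕ => (zetaReal α)⁻¹ * ((n : ℝ) + 1) ^ (-1 - α)) 1 := by
  have := (summable_rpow_neg hα).hasSum.mul_left (zetaReal α)⁻¹
  rwa [← zetaReal, inv_mul_cancel₀ (zetaReal_pos hα).ne'] at this

lemma hasSum_zetaProb (hα : 0 < α) : HasSum (zetaProb α) 1 := by
  rw [← injective_natCast_add_one.hasSum_iff fun k hk =>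
    zetaProb_of_le_zero (notMem_range_natCast_add_one hk)]
  have := Complex.hasSum_ofReal.mpr (hasSum_zetaProb_natCast_add_one hα)
  rw [Complex.ofReal_one] at this
  exact this.congr_fun fun n => (zetaProb_natCast_add_one hα n)

lemma l1Norm_zetaProb (hα : 0 < α) : l1Norm (zetaProb α) = 1 := by
  rw [l1Norm, ← injective_natCast_add_one.tsum_eq]
  · have h0 : ∀ n : ℕ, 0 ≤ (zetaReal α)⁻¹ * ((n : ℝ) + 1) ^ (-1 - α) := fun n => by
      have := zetaReal_pos hα
      positivity
    have h := hasSum_zetaProb_natCast_add_one hα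
    rw [← ENNReal.ofReal_one, ← h.tsum_eq, ENNReal.ofReal_tsum_of_nonneg h0 h.summable]
    refine tsum_congr fun n => ?_
    rw [zetaProb_natCast_add_one hα, ← ofReal_norm, Complex.norm_of_nonneg (h0 n)]
  · intro k hk
    by_contra h
    exact hk (by simp [zetaProb_of_le_zero (notMem_range_natCast_add_one h)])

lemma zetaProb_mem (hα : 0 < α) : zetaProb α ∈ ProbZplus := by
  have h : zetaProb α ∈ L1Z := by
    change l1Norm _ < ∞
    rw [l1Norm_zetaProb hα]
    exact ENNReal.one_lt_top
  refine ⟨⟨h, zetaProb_nonneg hα, hasSum_zetaProb hα⟩, h, fun k hk => ?_⟩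
  by_contra hk'
  exact hk (zetaProb_of_le_zero (by omega))

lemma norm_pow_le_one {z : ℂ} (hz : ‖z‖ ≤ 1) (k : ℕ) : ‖z ^ k‖ ≤ 1 := by
  rw [norm_pow]
  exact pow_le_one₀ (norm_nonneg _) hz

lemma hasSum_genFun_zetaProb (hα : 0 < α) {z : ℂ} (hz : ‖z‖ ≤ 1) :
    HasSum (fun n : ℕ => (((zetaReal α)⁻¹ * ((n : ℝ) + 1) ^ (-1 - α) : ℝ) : ℂ) * z ^ (n + 1))
      (genFun (zetaProb α) z) := by
  have h := (summable_norm_genFun (zetaProb_mem hα).2.1 (norm_pow_le_one hz)).of_norm.hasSum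
  have h2 := (hasSum_nat_add_iff' 1).mpr h
  simp only [Finset.range_one, Finset.sum_singleton, Nat.cast_zero, zetaProb_of_le_zero le_rfl,
    zero_smul, sub_zero] at h2
  refine h2.congr_fun fun n => ?_
  rw [smul_eq_mul, Nat.cast_add, Nat.cast_one, zetaProb_natCast_add_one hα]

lemma norm_add_mul_lt {p q : ℝ} (hp : 0 < p) (hq : 0 < q) {z : ℂ} (hz : ‖z‖ = 1) (hz1 : z ≠ 1) :
    ‖(p : ℂ) + q * z‖ < p + q := by
  have hns : z.re * z.re + z.im * z.im = 1 := by
    rw [← Complex.normSq_apply, Complex.normSq_eq_norm_sq, hz, one_pow]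
  have hre : z.re < 1 := by
    refine lt_of_le_of_ne (by nlinarith [sq_nonneg z.im]) fun h => hz1 ?_
    refine Complex.ext h ?_
    rw [h] at hns
    simpa using hns
  refine lt_of_pow_lt_pow_left₀ 2 (by positivity) ?_
  rw [← Complex.normSq_eq_norm_sq, Complex.normSq_apply]
  simp only [Complex.add_re, Complex.ofReal_re, Complex.mul_re, Complex.ofReal_im, zero_mul,
    sub_zero, Complex.add_im, Complex.mul_im, add_zero, zero_add]
  have h1 : (p + q * z.re) * (p + q * z.re) + q * z.im * (q * z.im) =
      p ^ 2 + q ^ 2 * (z.re * z.re + z.im * z.im) + 2 * (p * q) * z.re := by ring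
  rw [h1, hns]
  nlinarith [mul_pos (mul_pos hp hq) (sub_pos.mpr hre)]

/-- The two positive weights at 1 and 2 suffice: b₀z + b₁z² = z(b₀ + b₁z) is strictly shorter than
b₀ + b₁ for z ≠ 1, and the tail is bounded by its mass. -/
lemma norm_genFun_zetaProb_lt_one (hα : 0 < α) {z : ℂ} (hz : ‖z‖ = 1) (hz1 : z ≠ 1) :
    ‖genFun (zetaProb α) z‖ < 1 := by
  set b : ℕ → ℝ := fun n => (zetaReal α)⁻¹ * ((n : ℝ) + 1) ^ (-1 - α) with hb
  have hbpos : ∀ n, 0 < b n := fun n => by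
    have := zetaReal_pos hα
    positivity
  have h := hasSum_genFun_zetaProb hα hz.le
  have hB := hasSum_zetaProb_natCast_add_one hα
  have h2 := (hasSum_nat_add_iff' 2).mpr h
  have hB2 := (hasSum_nat_add_iff' 2).mpr hB
  have hle := tsum_of_norm_bounded hB2 (f := fun n : ℕ => (b (n + 2) : ℂ) * z ^ (n + 2 + 1))
    fun n => by
      rw [norm_mul, norm_pow, hz, one_pow, mul_one, Complex.norm_of_nonneg (hbpos _).le]
  rw [h2.tsum_eq] at hle
  have hlt := norm_add_mul_lt (hbpos 0) (hbpos 1) hz hz1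
  simp only [Finset.sum_range_succ, Finset.range_zero, Finset.sum_empty, zero_add] at hle
  change ‖genFun (zetaProb α) z - ((b 0 : ℂ) * z ^ 1 + (b 1 : ℂ) * z ^ (1 + 1))‖ ≤
    1 - (b 0 + b 1) at hle
  have hfac : (b 0 : ℂ) * z ^ 1 + (b 1 : ℂ) * z ^ (1 + 1) = z * (b 0 + b 1 * z) := by ring
  have hn : ‖(b 0 : ℂ) * z ^ 1 + (b 1 : ℂ) * z ^ (1 + 1)‖ < b 0 + b 1 := by
    rwa [hfac, norm_mul, hz, one_mul]
  have := norm_sub_norm_le (genFun (zetaProb α) z)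
    ((b 0 : ℂ) * z ^ 1 + (b 1 : ℂ) * z ^ (1 + 1))
  linarith

end ZetaProb

open MeasureTheory Set

/-! ### Sectorial estimates for a complete Bernstein function. -/

section Bernstein

/-- The envelope `y^(α-1) r / max(y, r)`. -/
noncomputable def envelope (α r y : ℝ) : ℝ := y ^ (α - 1) * (r / max y r)

variable {α : ℝ}

lemma envelope_nonneg {r y : ℝ} (hr : 0 ≤ r) (hy : 0 ≤ y) : 0 ≤ envelope α r y := by
  unfold envelope
  have : 0 ≤ max y r := le_max_of_le_left hy
  positivity

lemma envelope_eq_of_le {r y : ℝ} (hr : 0 < r) (hy : y ≤ r) : envelope α r y = y ^ (α - 1) := by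
  rw [envelope, max_eq_right hy, div_self hr.ne', mul_one]

lemma envelope_eq_of_lt {r y : ℝ} (hr : 0 < r) (hy : r < y) :
    envelope α r y = r * y ^ (α - 2) := by
  have hy0 : 0 < y := hr.trans hy
  rw [envelope, max_eq_left hy.le, show α - 2 = α - 1 - 1 by ring, Real.rpow_sub_one hy0.ne' (α - 1)]
  ring

lemma integrableOn_Ioc_rpow (hα : 0 < α) {r : ℝ} (hr : 0 < r) :
    IntegrableOn (fun y : ℝ => y ^ (α - 1)) (Ioc 0 r) := by
  rw [← intervalIntegrable_iff_integrableOn_Ioc_of_le hr.le]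
  exact intervalIntegral.intervalIntegrable_rpow' (by linarith)

lemma integral_Ioc_rpow (hα : 0 < α) {r : ℝ} (hr : 0 < r) :
    ∫ y in Ioc 0 r, y ^ (α - 1) = r ^ α / α := by
  rw [← intervalIntegral.integral_of_le hr.le, integral_rpow (Or.inl (by linarith)),
    sub_add_cancel, Real.zero_rpow hα.ne', sub_zero]

/-- Integrability at 0 uses α > 0, and at infinity, where the decay is y^(α-2), it uses α < 1. -/
lemma integrableOn_envelope (hα0 : 0 < α) (hα1 : α < 1) {r : ℝ} (hr : 0 < r) :
    IntegrableOn (envelope α r) (Ioi 0) := by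
  rw [← Ioc_union_Ioi_eq_Ioi hr.le]
  refine IntegrableOn.union ?_ ?_
  · exact (integrableOn_Ioc_rpow hα0 hr).congr_fun
      (fun y hy => (envelope_eq_of_le hr hy.2).symm) measurableSet_Ioc
  · exact IntegrableOn.congr_fun
      ((integrableOn_Ioi_rpow_of_lt (show α - 2 < -1 by linarith) hr).const_mul r)
      (fun y hy => (envelope_eq_of_lt hr hy).symm) measurableSet_Ioi

lemma integral_envelope (hα0 : 0 < α) (hα1 : α < 1) {r : ℝ} (hr : 0 < r) :
    ∫ y in Ioi 0, envelope α r y = (1 / α + 1 / (1 - α)) * r ^ α := by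
  have hi := integrableOn_envelope hα0 hα1 hr
  rw [← Ioc_union_Ioi_eq_Ioi hr.le] at hi ⊢
  rw [setIntegral_union (Ioc_disjoint_Ioi le_rfl) measurableSet_Ioi hi.left_of_union
    hi.right_of_union,
    setIntegral_congr_fun measurableSet_Ioc fun y hy => envelope_eq_of_le hr hy.2,
    setIntegral_congr_fun measurableSet_Ioi fun y hy => envelope_eq_of_lt hr hy,
    integral_Ioc_rpow hα0 hr, integral_const_mul,
    integral_Ioi_rpow_of_lt (show α - 2 < -1 by linarith) hr,
    show α - 2 + 1 = α - 1 by ring, Real.rpow_sub_one hr.ne']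
  have h1 : α - 1 ≠ 0 := by linarith
  have h2 : 1 - α ≠ 0 := by linarith
  rw [show 1 - α = -(α - 1) by ring]
  field_simp

/-- The kernel `log(1+y)^α w / (y (y+w))`. -/
noncomputable def bernsteinKernel (α : ℝ) (w : ℂ) (y : ℝ) : ℂ :=
  ((Real.log (1 + y) ^ α : ℝ) : ℂ) * (w / (y * (y + w)))

/-- The complete Bernstein function `∫_{y > 0} log(1+y)^α w / (y (y+w)) dy`. -/
noncomputable def bernstein (α : ℝ) (w : ℂ) : ℂ := ∫ y in Ioi (0 : ℝ), bernsteinKernel α w y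

lemma log_one_add_rpow_nonneg {y : ℝ} (hy : 0 ≤ y) : 0 ≤ Real.log (1 + y) ^ α :=
  Real.rpow_nonneg (Real.log_nonneg (by linarith)) _

lemma log_one_add_rpow_le (hα : 0 ≤ α) {y : ℝ} (hy : 0 ≤ y) : Real.log (1 + y) ^ α ≤ y ^ α := by
  refine Real.rpow_le_rpow (Real.log_nonneg (by linarith)) ?_ hα
  have := Real.log_le_sub_one_of_pos (show 0 < 1 + y by linarith)
  linarith

/-- From log(1+y) ≥ 1 - 1/(1+y) = y/(1+y) ≥ y/(1+R). -/
lemma le_log_one_add_rpow (hα : 0 ≤ α) {y R : ℝ} (hy : 0 ≤ y) (hR : y ≤ R) :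
    (1 + R) ^ (-α) * y ^ α ≤ Real.log (1 + y) ^ α := by
  have hR0 : 0 ≤ R := hy.trans hR
  rw [Real.rpow_neg (by linarith), ← Real.inv_rpow (by linarith),
    ← Real.mul_rpow (by positivity) hy]
  refine Real.rpow_le_rpow (by positivity) ?_ hα
  have h := Real.one_sub_inv_le_log_of_pos (show 0 < 1 + y by linarith)
  refine le_trans ?_ h
  rw [show 1 - (1 + y)⁻¹ = (1 + y)⁻¹ * y by field_simp; ring]
  gcongr

/-- In the sector Re w ≥ -κ|w|, |y+w|² ≥ y² + |w|² - 2κy|w| ≥ (1-κ)(y² + |w|²), the last step being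
κ(y-|w|)² ≥ 0. -/
lemma mul_max_le_norm_add {κ : ℝ} (hκ0 : 0 ≤ κ) (hκ1 : κ ≤ 1) {w : ℂ} (hw : -(κ * ‖w‖) ≤ w.re)
    {y : ℝ} (hy : 0 ≤ y) : (1 - κ) * max y ‖w‖ ≤ ‖(y : ℂ) + w‖ := by
  have hns : w.re * w.re + w.im * w.im = ‖w‖ ^ 2 := by
    rw [← Complex.normSq_apply, Complex.normSq_eq_norm_sq]
  have hr := norm_nonneg w
  have hm : (max y ‖w‖) ^ 2 ≤ y ^ 2 + ‖w‖ ^ 2 := by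
    rcases max_cases y ‖w‖ with h | h <;> rw [h.1] <;> nlinarith
  refine le_of_sq_le_sq ?_ (norm_nonneg _)
  rw [← Complex.normSq_eq_norm_sq, Complex.normSq_apply]
  simp only [Complex.add_re, Complex.ofReal_re, Complex.add_im, Complex.ofReal_im, zero_add]
  have h1 : (y + w.re) * (y + w.re) + w.im * w.im ≥ (1 - κ) * (y ^ 2 + ‖w‖ ^ 2) := by
    nlinarith [mul_le_mul_of_nonneg_left hw hy, mul_nonneg hκ0 (sq_nonneg (y - ‖w‖))]
  have h2 : (1 - κ) ^ 2 ≤ 1 - κ := by nlinarith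
  calc ((1 - κ) * max y ‖w‖) ^ 2 = (1 - κ) ^ 2 * max y ‖w‖ ^ 2 := by ring
    _ ≤ (1 - κ) * (y ^ 2 + ‖w‖ ^ 2) := by
      apply mul_le_mul h2 hm (by positivity) (by linarith)
    _ ≤ _ := h1

lemma norm_bernsteinKernel_le (hα : 0 ≤ α) {κ : ℝ} (hκ0 : 0 ≤ κ) (hκ1 : κ < 1) {w : ℂ}
    (hw : -(κ * ‖w‖) ≤ w.re) {y : ℝ} (hy : 0 < y) :
    ‖bernsteinKernel α w y‖ ≤ (1 - κ)⁻¹ * envelope α ‖w‖ y := by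
  have hm : 0 < max y ‖w‖ := lt_max_of_lt_left hy
  have h1 := mul_max_le_norm_add hκ0 hκ1.le hw hy.le
  have hκ : 0 < 1 - κ := by linarith
  rw [bernsteinKernel, norm_mul, norm_div, norm_mul, Complex.norm_of_nonneg
    (log_one_add_rpow_nonneg hy.le), Complex.norm_of_nonneg hy.le]
  calc Real.log (1 + y) ^ α * (‖w‖ / (y * ‖(y : ℂ) + w‖))
      ≤ y ^ α * (‖w‖ / (y * ((1 - κ) * max y ‖w‖))) := by
        gcongr ?_ * (‖w‖ / (y * ?_))
        exact log_one_add_rpow_le hα hy.le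
    _ = _ := by
        rw [envelope, Real.rpow_sub_one hy.ne']
        field_simp

lemma measurable_bernsteinKernel (w : ℂ) : Measurable (bernsteinKernel α w) := by
  unfold bernsteinKernel
  fun_prop

lemma integrableOn_bernsteinKernel (hα0 : 0 < α) (hα1 : α < 1) {κ : ℝ} (hκ0 : 0 ≤ κ) (hκ1 : κ < 1)
    {w : ℂ} (hw0 : w ≠ 0) (hw : -(κ * ‖w‖) ≤ w.re) :
    IntegrableOn (bernsteinKernel α w) (Ioi 0) := by
  refine Integrable.mono' ((integrableOn_envelope hα0 hα1 (norm_pos_iff.mpr hw0)).const_mul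
    (1 - κ)⁻¹) (measurable_bernsteinKernel w).aestronglyMeasurable ?_
  exact (ae_restrict_iff' measurableSet_Ioi).mpr
    (.of_forall fun y hy => norm_bernsteinKernel_le hα0.le hκ0 hκ1 hw hy)

lemma norm_bernstein_le (hα0 : 0 < α) (hα1 : α < 1) {κ : ℝ} (hκ0 : 0 ≤ κ) (hκ1 : κ < 1)
    {w : ℂ} (hw0 : w ≠ 0) (hw : -(κ * ‖w‖) ≤ w.re) :
    ‖bernstein α w‖ ≤ (1 - κ)⁻¹ * (1 / α + 1 / (1 - α)) * ‖w‖ ^ α := by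
  have hr := norm_pos_iff.mpr hw0
  rw [mul_assoc, ← integral_envelope hα0 hα1 hr, ← integral_const_mul]
  exact norm_integral_le_of_norm_le ((integrableOn_envelope hα0 hα1 hr).const_mul _)
    ((ae_restrict_iff' measurableSet_Ioi).mpr
      (.of_forall fun y hy => norm_bernsteinKernel_le hα0.le hκ0 hκ1 hw hy))

lemma re_bernsteinKernel (w : ℂ) (y : ℝ) :
    (bernsteinKernel α w y).re =
      Real.log (1 + y) ^ α * ((y * w.re + ‖w‖ ^ 2) / (y * ‖(y : ℂ) + w‖ ^ 2)) := by
  rw [bernsteinKernel, Complex.re_ofReal_mul, ← div_div, div_right_comm, Complex.div_ofReal_re,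
    Complex.div_re, ← Complex.normSq_eq_norm_sq, ← Complex.normSq_eq_norm_sq, Complex.normSq_apply w]
  simp only [Complex.add_re, Complex.ofReal_re, Complex.add_im, Complex.ofReal_im, zero_add]
  congr 1
  rw [← add_div, div_div, mul_comm y (Complex.normSq _)]
  congr 1
  ring

/-- The numerator y Re w + |w|² of the real part splits. The term |w|² is kept only for y ≤ |w|,
where it dominates; a slightly negative Re w costs at most a multiple of η times the envelope. -/
lemma le_re_bernsteinKernel (hα : 0 ≤ α) {η R : ℝ} (hη0 : 0 ≤ η) (hη1 : η ≤ 1 / 2)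
    {w : ℂ} (hw0 : w ≠ 0) (hw : -(η * ‖w‖) ≤ w.re) (hR : ‖w‖ ≤ R) {y : ℝ} (hy : 0 < y) :
    (Ioc 0 ‖w‖).indicator (fun y => (1 + R) ^ (-α) / 4 * y ^ (α - 1)) y
      - 4 * η * envelope α ‖w‖ y ≤ (bernsteinKernel α w y).re := by
  have hr := norm_pos_iff.mpr hw0
  set r := ‖w‖ with hrdef
  have hm : 0 < max y r := lt_max_of_lt_left hy
  have hlow : 1 / 2 * max y r ≤ ‖(y : ℂ) + w‖ := by
    refine le_trans ?_ (mul_max_le_norm_add hη0 (hη1.trans (by norm_num)) hw hy.le)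
    exact mul_le_mul_of_nonneg_right (by linarith) hm.le
  set N := ‖(y : ℂ) + w‖ with hN
  have hNpos : 0 < N := lt_of_lt_of_le (by positivity) hlow
  have hL0 := log_one_add_rpow_nonneg (α := α) hy.le
  have hL1 := log_one_add_rpow_le hα hy.le
  have hup : N ≤ y + r := by
    refine (norm_add_le _ _).trans ?_
    rw [Complex.norm_of_nonneg hy.le]
  have hneg : Real.log (1 + y) ^ α * (η * r / N ^ 2) ≤ 4 * η * envelope α r y := by
    have h1 : Real.log (1 + y) ^ α * (η * r / N ^ 2) ≤
        y ^ α * (η * r / (1 / 2 * max y r) ^ 2) := by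
      gcongr
    refine h1.trans ?_
    have h2 : y ^ α * (η * r / (1 / 2 * max y r) ^ 2) =
        4 * η * (y ^ (α - 1) * (r / max y r)) * (y / max y r) := by
      rw [Real.rpow_sub_one hy.ne']
      field_simp
      ring
    rw [h2, envelope]
    refine mul_le_of_le_one_right (by positivity) ?_
    exact (div_le_one hm).mpr (le_max_left _ _)
  have hpos : (Ioc 0 r).indicator (fun y => (1 + R) ^ (-α) / 4 * y ^ (α - 1)) y ≤
      Real.log (1 + y) ^ α * (r ^ 2 / (y * N ^ 2)) := by
    by_cases hyr : y ∈ Ioc 0 r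
    · rw [indicator_of_mem hyr]
      -- For y ≤ r one has N ≤ y + r ≤ 2r.
      have h3 : 1 / (4 * y) ≤ r ^ 2 / (y * N ^ 2) := by
        rw [div_le_div_iff₀ (by positivity) (by positivity)]
        have : N ^ 2 ≤ (2 * r) ^ 2 := by gcongr; linarith [hyr.2]
        nlinarith
      calc (1 + R) ^ (-α) / 4 * y ^ (α - 1) = (1 + R) ^ (-α) * y ^ α * (1 / (4 * y)) := by
            rw [Real.rpow_sub_one hy.ne']
            field_simp
        _ ≤ _ := by
            refine mul_le_mul (le_log_one_add_rpow hα hy.le (hyr.2.trans hR)) h3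
              (by positivity) hL0
    · rw [indicator_of_notMem hyr]
      positivity
  rw [re_bernsteinKernel w y]
  have h4 : r ^ 2 / (y * N ^ 2) - η * r / N ^ 2 ≤ (y * w.re + r ^ 2) / (y * N ^ 2) := by
    rw [show r ^ 2 / (y * N ^ 2) - η * r / N ^ 2 = (y * -(η * r) + r ^ 2) / (y * N ^ 2) by
      field_simp; ring]
    gcongr
  have h5 := mul_le_mul_of_nonneg_left h4 hL0
  rw [mul_sub] at h5
  linarith

lemma le_re_bernstein (hα0 : 0 < α) (hα1 : α < 1) {η R : ℝ} (hη0 : 0 ≤ η) (hη1 : η ≤ 1 / 2)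
    {w : ℂ} (hw0 : w ≠ 0) (hw : -(η * ‖w‖) ≤ w.re) (hR : ‖w‖ ≤ R) :
    ((1 + R) ^ (-α) / (4 * α) - 4 * η * (1 / α + 1 / (1 - α))) * ‖w‖ ^ α ≤
      (bernstein α w).re := by
  have hr := norm_pos_iff.mpr hw0
  have hint := integrableOn_bernsteinKernel hα0 hα1 hη0 (hη1.trans_lt (by norm_num)) hw0 hw
  have hre : (bernstein α w).re = ∫ y in Ioi (0 : ℝ), (bernsteinKernel α w y).re :=
    (integral_re hint).symm
  have hE := (integrableOn_envelope hα0 hα1 hr).const_mul (4 * η)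
  have hI0 := (integrableOn_Ioc_rpow hα0 hr).const_mul ((1 + R) ^ (-α) / 4)
  have hI : IntegrableOn ((Ioc 0 ‖w‖).indicator fun y => (1 + R) ^ (-α) / 4 * y ^ (α - 1))
      (Ioi 0) := ((integrable_indicator_iff measurableSet_Ioc).mpr hI0).integrableOn
  have hmono := setIntegral_mono_on (hI.sub hE) hint.re measurableSet_Ioi
    fun y hy => le_re_bernsteinKernel hα0.le hη0 hη1 hw0 hw hR hy
  have hval : ∫ y in Ioi (0 : ℝ),
      (Ioc 0 ‖w‖).indicator (fun y => (1 + R) ^ (-α) / 4 * y ^ (α - 1)) y =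
      (1 + R) ^ (-α) / 4 * (‖w‖ ^ α / α) := by
    rw [setIntegral_indicator measurableSet_Ioc, inter_eq_right.mpr Ioc_subset_Ioi_self,
      integral_const_mul, integral_Ioc_rpow hα0 hr]
  rw [hre]
  refine le_trans (le_of_eq ?_) hmono
  have hsub := integral_sub hI hE
  rw [integral_const_mul, hval, integral_envelope hα0 hα1 hr] at hsub
  refine Eq.trans ?_ hsub.symm
  field_simp

/-- Note w/(y(y+w)) = 1/y - 1/(y+w). -/
lemma hasDerivAt_bernsteinKernel {w : ℂ} {y : ℝ} (hy : 0 < y) (hyw : (y : ℂ) + w ≠ 0) :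
    HasDerivAt (fun w => bernsteinKernel α w y)
      (((Real.log (1 + y) ^ α : ℝ) : ℂ) * (1 / ((y : ℂ) + w) ^ 2)) w := by
  have hy' : (y : ℂ) ≠ 0 := by exact_mod_cast hy.ne'
  have h1 : HasDerivAt (fun w : ℂ => (y : ℂ) * (y + w)) (y * 1) w :=
    ((hasDerivAt_id w).const_add (y : ℂ)).const_mul (y : ℂ)
  have h2 := ((hasDerivAt_id w).div h1 (mul_ne_zero hy' hyw)).const_mul
    ((Real.log (1 + y) ^ α : ℝ) : ℂ)
  refine h2.congr_deriv ?_
  simp only [id]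
  field_simp
  ring

lemma exists_neg_mul_norm_lt_re {w : ℂ} (hw : w ∈ Complex.slitPlane) :
    ∃ κ : ℝ, 0 ≤ κ ∧ κ < 1 ∧ -(κ * ‖w‖) < w.re := by
  have hr : 0 < ‖w‖ := norm_pos_iff.mpr (Complex.slitPlane_ne_zero hw)
  have hlt : -w.re / ‖w‖ < 1 := by
    rw [div_lt_one hr]
    rcases Complex.mem_slitPlane_iff.mp hw with h | h
    · linarith
    · exact (neg_le_abs _).trans_lt (Complex.abs_re_lt_norm.mpr h)
  obtain ⟨κ, h1, h2⟩ := exists_between (max_lt hlt zero_lt_one)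
  refine ⟨κ, (le_max_right _ _).trans h1.le, h2, ?_⟩
  have := (le_max_left _ _).trans_lt h1
  rw [div_lt_iff₀ hr] at this
  linarith

lemma differentiableOn_bernstein (hα0 : 0 < α) (hα1 : α < 1) :
    DifferentiableOn ℂ (bernstein α) Complex.slitPlane := by
  intro w₀ hw₀
  refine DifferentiableAt.differentiableWithinAt ?_
  obtain ⟨κ, hκ0, hκ1, hw⟩ := exists_neg_mul_norm_lt_re hw₀
  have hr : 0 < ‖w₀‖ := norm_pos_iff.mpr (Complex.slitPlane_ne_zero hw₀)
  have hκ : 0 < 1 - κ := by linarith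
  -- An open sector with a disc about 0 removed: there the derivative is dominated by one fixed
  -- multiple of the envelope at ‖w₀‖/2.
  have hs : {w : ℂ | -(κ * ‖w‖) < w.re ∧ ‖w₀‖ / 2 < ‖w‖} ∈ nhds w₀ := by
    refine IsOpen.mem_nhds (IsOpen.inter ?_ ?_) ⟨hw, by simpa using hr⟩
    · exact isOpen_lt (by fun_prop) Complex.continuous_re
    · exact isOpen_lt continuous_const continuous_norm
  refine (hasDerivAt_integral_of_dominated_loc_of_deriv_le
    (bound := fun y => ((1 - κ) ^ 2)⁻¹ * (‖w₀‖ / 2)⁻¹ * envelope α (‖w₀‖ / 2) y)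
    (F' := fun w y => ((Real.log (1 + y) ^ α : ℝ) : ℂ) * (1 / ((y : ℂ) + w) ^ 2)) hs
    (.of_forall fun w => (measurable_bernsteinKernel w).aestronglyMeasurable)
    (integrableOn_bernsteinKernel hα0 hα1 hκ0 hκ1 (Complex.slitPlane_ne_zero hw₀) hw.le)
    ?_ ?_ ?_ ?_).2.differentiableAt
  · exact Measurable.aestronglyMeasurable (by fun_prop)
  · refine (ae_restrict_iff' measurableSet_Ioi).mpr (.of_forall fun y (hy : 0 < y) w hw => ?_)
    have h1 := mul_max_le_norm_add hκ0 hκ1.le hw.1.le hy.le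
    have hmm : max y (‖w₀‖ / 2) ≤ max y ‖w‖ := max_le_max le_rfl hw.2.le
    have hm : 0 < max y (‖w₀‖ / 2) := lt_max_of_lt_left hy
    have h2 := (mul_le_mul_of_nonneg_left hmm hκ.le).trans h1
    rw [norm_mul, norm_div, norm_one, norm_pow, Complex.norm_of_nonneg
      (log_one_add_rpow_nonneg hy.le)]
    calc Real.log (1 + y) ^ α * (1 / ‖(y : ℂ) + w‖ ^ 2)
        ≤ y ^ α * (1 / ((1 - κ) * max y (‖w₀‖ / 2)) ^ 2) := by
          gcongr ?_ * (1 / ?_ ^ 2)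
          exact log_one_add_rpow_le hα0.le hy.le
      _ = ((1 - κ) ^ 2)⁻¹ * (‖w₀‖ / 2)⁻¹ * envelope α (‖w₀‖ / 2) y * (y / max y (‖w₀‖ / 2)) := by
          rw [envelope, Real.rpow_sub_one hy.ne']
          field_simp
      _ ≤ _ := by
          refine mul_le_of_le_one_right ?_ ((div_le_one hm).mpr (le_max_left _ _))
          have := envelope_nonneg (α := α) (half_pos hr).le hy.le
          positivity
  · exact (integrableOn_envelope hα0 hα1 (half_pos hr)).const_mul _
  · refine (ae_restrict_iff' measurableSet_Ioi).mpr (.of_forall fun y (hy : 0 < y) w hw => ?_)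
    refine hasDerivAt_bernsteinKernel hy (norm_pos_iff.mp ?_)
    refine lt_of_lt_of_le ?_ (mul_max_le_norm_add hκ0 hκ1.le hw.1.le hy.le)
    have : 0 < max y ‖w‖ := lt_max_of_lt_left hy
    positivity

/-- The kernel is real for real w. No convergence is needed, as a divergent integral has the value
0. -/
lemma bernstein_ofReal_im (α t : ℝ) : (bernstein α (t : ℂ)).im = 0 := by
  have h : bernstein α (t : ℂ) =
      ((∫ y in Ioi (0 : ℝ), Real.log (1 + y) ^ α * (t / (y * (y + t))) : ℝ) : ℂ) := by
    rw [bernstein, ← integral_complex_ofReal]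
    refine integral_congr_ae (.of_forall fun y => ?_)
    simp only [bernsteinKernel]
    push_cast
    rfl
  rw [h, Complex.ofReal_im]

end Bernstein

/-! ### Analytic continuation of the generating function. -/

section Continuation

variable {α : ℝ}

lemma image_exp_sub_one_Ioi : (fun x : ℝ => Real.exp x - 1) '' Ioi 0 = Ioi 0 := by
  ext y
  constructor
  · rintro ⟨x, hx, rfl⟩
    exact sub_pos.mpr (Real.one_lt_exp_iff.mpr hx)
  · intro hy
    have hy : 0 < y := hy
    exact ⟨Real.log (1 + y), Real.log_pos (by linarith), by
      simp only
      rw [Real.exp_log (by linarith)]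
      ring⟩

/-- The substitution y = e^x - 1 turns the integral into the Gamma integral of x^α e^{-(n+1)x}. -/
lemma integral_log_one_add_rpow_mul (hα : 0 < α) (n : ℕ) :
    ∫ y in Ioi (0 : ℝ), Real.log (1 + y) ^ α * ((1 + y) ^ (n + 2))⁻¹ =
      Real.Gamma (1 + α) * ((n : ℝ) + 1) ^ (-1 - α) := by
  have h := integral_image_eq_integral_abs_deriv_smul (f := fun x : ℝ => Real.exp x - 1)
    (f' := Real.exp) (measurableSet_Ioi (a := (0 : ℝ)))
    (fun x _ => ((Real.hasDerivAt_exp x).sub_const 1).hasDerivWithinAt)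
    (fun x _ y _ hxy => Real.exp_injective (sub_left_injective hxy))
    (fun y => Real.log (1 + y) ^ α * ((1 + y) ^ (n + 2))⁻¹)
  rw [image_exp_sub_one_Ioi] at h
  rw [h]
  have h2 := Real.integral_rpow_mul_exp_neg_mul_Ioi (show 0 < 1 + α by linarith)
    (show (0 : ℝ) < n + 1 by positivity)
  rw [one_div, Real.inv_rpow (by positivity), ← Real.rpow_neg (by positivity)] at h2
  rw [mul_comm (Real.Gamma _), show -1 - α = -(1 + α) by ring, ← h2]
  refine integral_congr_ae (.of_forall fun x => ?_)
  simp only [smul_eq_mul, abs_of_pos (Real.exp_pos x), add_sub_cancel, Real.log_exp,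
    add_sub_cancel_left]
  rw [← Real.exp_nat_mul, ← Real.exp_neg, mul_left_comm, ← Real.exp_add]
  congr 2
  push_cast
  ring

lemma integrableOn_log_one_add_rpow_mul (hα : 0 < α) (n : ℕ) :
    IntegrableOn (fun y : ℝ => Real.log (1 + y) ^ α * ((1 + y) ^ (n + 2))⁻¹) (Ioi 0) := by
  -- A non-integrable function would have integral 0, but the value just computed is positive.
  refine Integrable.of_integral_ne_zero ?_
  rw [integral_log_one_add_rpow_mul hα]
  have := Real.Gamma_pos_of_pos (show 0 < 1 + α by linarith)
  positivity

/-- With w = 1 - z, w/(y(y+w)) = 1/y - 1/(1+y-z); the two terms are compared with geometric series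
of ratios 1/(1+y) and z/(1+y). -/
lemma hasSum_bernsteinKernel {z : ℂ} (hz : ‖z‖ ≤ 1) {y : ℝ} (hy : 0 < y) :
    HasSum (fun n : ℕ => ((Real.log (1 + y) ^ α * ((1 + y) ^ (n + 2))⁻¹ : ℝ) : ℂ) *
      (1 - z ^ (n + 1))) (bernsteinKernel α (1 - z) y) := by
  have h1y : (1 : ℝ) < 1 + y := by linarith
  have hy0 : (y : ℂ) ≠ 0 := by exact_mod_cast hy.ne'
  have h1y0 : (1 : ℂ) + y ≠ 0 := by exact_mod_cast (show (1 : ℝ) + y ≠ 0 by linarith)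
  have hnorm : ‖(1 : ℂ) + y‖ = 1 + y := by
    rw [← Complex.ofReal_one, ← Complex.ofReal_add, Complex.norm_of_nonneg (by linarith)]
  have hz1 : (1 : ℂ) + y - z ≠ 0 := fun h => by
    rw [sub_eq_zero] at h
    rw [← h, hnorm] at hz
    linarith
  have g1 : HasSum (fun n : ℕ => ((1 : ℂ) / (1 + y)) ^ n) _ :=
    hasSum_geometric_of_norm_lt_one (by
      rw [norm_div, norm_one, hnorm]
      exact (div_lt_one (by linarith)).mpr h1y)
  have g2 : HasSum (fun n : ℕ => (z / (1 + y)) ^ n) _ :=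
    hasSum_geometric_of_norm_lt_one (by
      rw [norm_div, hnorm]
      exact (div_lt_one (by linarith)).mpr (by linarith))
  have g := ((g1.mul_left (1 / (1 + (y : ℂ)) ^ 2)).sub
    (g2.mul_left (z / (1 + (y : ℂ)) ^ 2))).mul_left ((Real.log (1 + y) ^ α : ℝ) : ℂ)
  have hval : bernsteinKernel α (1 - z) y = ((Real.log (1 + y) ^ α : ℝ) : ℂ) *
      (1 / (1 + (y : ℂ)) ^ 2 * (1 - 1 / (1 + (y : ℂ)))⁻¹ -
        z / (1 + (y : ℂ)) ^ 2 * (1 - z / (1 + (y : ℂ)))⁻¹) := by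
    rw [bernsteinKernel]
    congr 1
    have e1 : 1 - 1 / (1 + (y : ℂ)) = y / (1 + y) := by field_simp; ring
    have e2 : 1 - z / (1 + (y : ℂ)) = (1 + y - z) / (1 + y) := by field_simp
    have e3 : (y : ℂ) + (1 - z) = 1 + y - z := by ring
    rw [e1, e2, e3]
    field_simp
    ring
  rw [hval]
  refine g.congr_fun fun n => ?_
  push_cast
  rw [div_pow, div_pow, one_pow]
  field_simp
  ring

/-- The constant `Γ(1+α) ζ(1+α)`. -/
noncomputable def boseConst (α : ℝ) : ℝ := Real.Gamma (1 + α) * zetaReal α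

lemma boseConst_pos (hα : 0 < α) : 0 < boseConst α :=
  mul_pos (Real.Gamma_pos_of_pos (by linarith)) (zetaReal_pos hα)

/-- Term by term integration of `hasSum_bernsteinKernel` gives Γ(1+α) ∑ (n+1)^{-1-α} (1 - z^{n+1});
|1 - z^{n+1}| ≤ 2 justifies the interchange. -/
lemma boseConst_mul_one_sub_genFun (hα : 0 < α) {z : ℂ} (hz : ‖z‖ ≤ 1) :
    (boseConst α : ℂ) * (1 - genFun (zetaProb α) z) = bernstein α (1 - z) := by
  set F : ℕ → ℝ → ℂ := fun n y =>
    ((Real.log (1 + y) ^ α * ((1 + y) ^ (n + 2))⁻¹ : ℝ) : ℂ) * (1 - z ^ (n + 1)) with hF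
  have hint : ∀ n, IntegrableOn (F n) (Ioi 0) := fun n =>
    (integrableOn_log_one_add_rpow_mul hα n).ofReal.mul_const _
  have hval : ∀ n, ∫ y in Ioi (0 : ℝ), F n y =
      ((Real.Gamma (1 + α) * ((n : ℝ) + 1) ^ (-1 - α) : ℝ) : ℂ) * (1 - z ^ (n + 1)) := fun n => by
    rw [hF, integral_mul_const, integral_complex_ofReal, integral_log_one_add_rpow_mul hα]
  have hnval : ∀ n, ∫ y in Ioi (0 : ℝ), ‖F n y‖ =
      Real.Gamma (1 + α) * ((n : ℝ) + 1) ^ (-1 - α) * ‖1 - z ^ (n + 1)‖ := fun n => by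
    rw [← integral_log_one_add_rpow_mul hα, ← integral_mul_const]
    refine setIntegral_congr_fun measurableSet_Ioi fun y (hy : 0 < y) => ?_
    simp only [hF]
    rw [norm_mul, Complex.norm_of_nonneg]
    have := log_one_add_rpow_nonneg (α := α) hy.le
    positivity
  have hΓ := Real.Gamma_pos_of_pos (show 0 < 1 + α by linarith)
  have hsum : Summable fun n => ∫ y in Ioi (0 : ℝ), ‖F n y‖ := by
    simp_rw [hnval]
    refine Summable.of_nonneg_of_le (fun n => by positivity) (fun n => ?_)
      (((summable_rpow_neg hα).mul_left (Real.Gamma (1 + α))).mul_right 2)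
    refine mul_le_mul_of_nonneg_left ?_ (by positivity)
    refine (norm_sub_le _ _).trans ?_
    have := norm_pow_le_one hz (n + 1)
    rw [norm_one]
    linarith
  have h := hasSum_integral_of_summable_integral_norm hint hsum
  simp_rw [hval] at h
  have hb : ∫ y in Ioi (0 : ℝ), ∑' n, F n y = bernstein α (1 - z) :=
    setIntegral_congr_fun measurableSet_Ioi fun y hy => (hasSum_bernsteinKernel hz hy).tsum_eq
  rw [hb] at h
  have h1 := Complex.hasSum_ofReal.mpr (hasSum_zetaProb_natCast_add_one hα)
  have h2 := (h1.sub (hasSum_genFun_zetaProb hα hz)).mul_left (boseConst α : ℂ)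
  rw [Complex.ofReal_one] at h2
  refine h2.unique (h.congr_fun fun n => ?_)
  have hζ : (zetaReal α : ℂ) ≠ 0 := by exact_mod_cast (zetaReal_pos hα).ne'
  rw [boseConst]
  push_cast
  field_simp

/-- The analytic continuation of the generating function of `zetaProb α` to the plane slit along
`[1, ∞)`. -/
noncomputable def zetaGen (α : ℝ) (z : ℂ) : ℂ := 1 - bernstein α (1 - z) / boseConst α

lemma zetaGen_eq_genFun (hα : 0 < α) {z : ℂ} (hz : ‖z‖ ≤ 1) :
    zetaGen α z = genFun (zetaProb α) z := by
  have : (boseConst α : ℂ) ≠ 0 := by exact_mod_cast (boseConst_pos hα).ne'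
  rw [zetaGen, ← boseConst_mul_one_sub_genFun hα hz, mul_div_cancel_left₀ _ this, sub_sub_cancel]

lemma differentiableOn_zetaGen (hα0 : 0 < α) (hα1 : α < 1) :
    DifferentiableOn ℂ (zetaGen α) {z | 1 - z ∈ Complex.slitPlane} := by
  refine DifferentiableOn.const_sub (DifferentiableOn.div_const ?_ _) _
  exact (differentiableOn_bernstein hα0 hα1).comp (by fun_prop) fun z hz => hz

lemma zetaGen_ofReal_im (α t : ℝ) : (zetaGen α (t : ℂ)).im = 0 := by
  have h := bernstein_ofReal_im α (1 - t)
  push_cast at h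
  rw [zetaGen, Complex.sub_im, Complex.div_ofReal_im, h]
  simp

end Continuation

/-! ### Geometry of logarithmic spirals near 1. -/

section Spiral

/-- The point `e^{(ε + i)θ}` of a logarithmic spiral. -/
noncomputable def spiral (ε θ : ℝ) : ℂ := Complex.exp (((ε : ℂ) + Complex.I) * θ)

lemma spiral_re (ε θ : ℝ) : (spiral ε θ).re = Real.exp (ε * θ) * Real.cos θ := by
  simp [spiral, Complex.exp_re]

lemma spiral_im (ε θ : ℝ) : (spiral ε θ).im = Real.exp (ε * θ) * Real.sin θ := by
  simp [spiral, Complex.exp_im]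

lemma norm_spiral (ε θ : ℝ) : ‖spiral ε θ‖ = Real.exp (ε * θ) := by
  simp [spiral, Complex.norm_exp]

lemma norm_one_sub_spiral_sq (ε θ : ℝ) : ‖1 - spiral ε θ‖ ^ 2 =
    (Real.exp (ε * θ) - 1) ^ 2 + 2 * Real.exp (ε * θ) * (1 - Real.cos θ) := by
  rw [← Complex.normSq_eq_norm_sq, Complex.normSq_apply]
  simp only [Complex.sub_re, Complex.sub_im, Complex.one_re, Complex.one_im, spiral_re, spiral_im]
  have := Real.sin_sq_add_cos_sq θ
  linear_combination (Real.exp (ε * θ)) ^ 2 * this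

lemma one_sub_exp_mem_slitPlane {s : ℂ} (h0 : 0 < s.im) (h1 : s.im < 2 * Real.pi) :
    1 - Complex.exp s ∈ Complex.slitPlane := by
  rw [Complex.mem_slitPlane_iff, Complex.sub_re, Complex.sub_im, Complex.exp_re, Complex.exp_im,
    Complex.one_re, Complex.one_im]
  have hE := Real.exp_pos s.re
  rcases lt_trichotomy s.im Real.pi with h | h | h
  · right
    have := mul_pos hE (Real.sin_pos_of_pos_of_lt_pi h0 h)
    linarith
  · left
    rw [h, Real.cos_pi]
    linarith
  · right
    have h2 := Real.sin_pos_of_pos_of_lt_pi (sub_pos.mpr h) (by linarith)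
    rw [Real.sin_sub_pi] at h2
    have := mul_pos hE h2
    linarith

variable {ε θ : ℝ}

lemma one_sub_spiral_mem_slitPlane (ε : ℝ) (hθ0 : 0 < θ) (hθ1 : θ ≤ Real.pi) :
    1 - spiral ε θ ∈ Complex.slitPlane :=
  one_sub_exp_mem_slitPlane (by simpa using hθ0)
    (by simpa using lt_of_le_of_lt hθ1 (by linarith [Real.pi_pos]))

lemma two_div_pi_mul_le_norm_one_sub_spiral (hε : 0 ≤ ε) (hθ0 : 0 ≤ θ) (hθ1 : θ ≤ Real.pi) :
    2 / Real.pi * θ ≤ ‖1 - spiral ε θ‖ := by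
  refine le_of_sq_le_sq ?_ (norm_nonneg _)
  rw [norm_one_sub_spiral_sq]
  have h1 := Real.cos_le_one_sub_mul_cos_sq (x := θ) (by rwa [abs_of_nonneg hθ0])
  have h2 : 1 ≤ Real.exp (ε * θ) := Real.one_le_exp (by positivity)
  have h3 : (2 / Real.pi * θ) ^ 2 = 2 * (2 / Real.pi ^ 2 * θ ^ 2) := by ring
  rw [h3]
  nlinarith [sq_nonneg (Real.exp (ε * θ) - 1), Real.cos_le_one θ]

/-- From e^{-t} ≥ 1 - t follows e^t - 1 ≤ t e^t, with t = εθ ≤ π. -/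
lemma exp_mul_sub_one_le (hε0 : 0 ≤ ε) (hε1 : ε ≤ 1) (hθ0 : 0 ≤ θ) (hθ1 : θ ≤ Real.pi) :
    Real.exp (ε * θ) - 1 ≤ ε * θ * Real.exp Real.pi := by
  have h1 := Real.add_one_le_exp (-(ε * θ))
  have h2 : Real.exp (ε * θ) * Real.exp (-(ε * θ)) = 1 := by rw [← Real.exp_add]; simp
  have h3 : Real.exp (ε * θ) ≤ Real.exp Real.pi :=
    Real.exp_le_exp.mpr ((mul_le_of_le_one_left hθ0 hε1).trans hθ1)
  have h4 := Real.exp_pos (ε * θ)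
  have h5 : 0 ≤ ε * θ := by positivity
  nlinarith [mul_le_mul_of_nonneg_left h1 h4.le, mul_le_mul_of_nonneg_left h3 h5]

lemma norm_one_sub_spiral_le (hε0 : 0 ≤ ε) (hε1 : ε ≤ 1) (hθ0 : 0 ≤ θ) (hθ1 : θ ≤ Real.pi) :
    ‖1 - spiral ε θ‖ ≤ 2 * Real.exp Real.pi * θ := by
  refine le_of_sq_le_sq ?_ (by positivity)
  rw [norm_one_sub_spiral_sq]
  have h1 := exp_mul_sub_one_le hε0 hε1 hθ0 hθ1
  have h2 : 1 ≤ Real.exp (ε * θ) := Real.one_le_exp (by positivity)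
  have h3 : Real.exp (ε * θ) ≤ Real.exp Real.pi :=
    Real.exp_le_exp.mpr ((mul_le_of_le_one_left hθ0 hε1).trans hθ1)
  have h4 := Real.one_sub_sq_div_two_le_cos (x := θ)
  set B := Real.exp Real.pi
  have h5 : ε * θ * B ≤ θ * B := by
    have := mul_le_of_le_one_left hθ0 hε1
    gcongr
  have h6 : (Real.exp (ε * θ) - 1) ^ 2 ≤ (θ * B) ^ 2 := by
    gcongr
    linarith
  have h7 : 2 * Real.exp (ε * θ) * (1 - Real.cos θ) ≤ 2 * B * (θ ^ 2 / 2) := by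
    refine mul_le_mul (by linarith) (by linarith) (by linarith [Real.cos_le_one θ]) (by positivity)
  have hB : 1 ≤ B := h2.trans h3
  nlinarith [mul_nonneg (mul_nonneg (sub_nonneg.mpr hB) (zero_le_one.trans hB)) (sq_nonneg θ)]

/-- The real part is at least 1 - e^{εθ} ≥ -εθe^π, and θ is at most (π/2)|1 - spiral|. Thus a small
ε keeps the spiral in a sector barely wider than the half plane. -/
lemma neg_mul_norm_le_re_one_sub_spiral (hε0 : 0 ≤ ε) (hε1 : ε ≤ 1) (hθ0 : 0 ≤ θ)
    (hθ1 : θ ≤ Real.pi) :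
    -(ε * Real.exp Real.pi * (Real.pi / 2) * ‖1 - spiral ε θ‖) ≤ (1 - spiral ε θ).re := by
  rw [Complex.sub_re, spiral_re, Complex.one_re]
  have h1 := exp_mul_sub_one_le hε0 hε1 hθ0 hθ1
  have h2 : Real.exp (ε * θ) * Real.cos θ ≤ Real.exp (ε * θ) :=
    mul_le_of_le_one_right (Real.exp_pos _).le (Real.cos_le_one θ)
  have h3 := two_div_pi_mul_le_norm_one_sub_spiral hε0 hθ0 hθ1
  have h4 : θ ≤ Real.pi / 2 * ‖1 - spiral ε θ‖ := by
    have := mul_le_mul_of_nonneg_left h3 (show 0 ≤ Real.pi / 2 by positivity)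
    have e : Real.pi / 2 * (2 / Real.pi * θ) = θ := by field_simp
    linarith
  have h5 := mul_le_mul_of_nonneg_left h4 (show 0 ≤ ε * Real.exp Real.pi by positivity)
  nlinarith

end Spiral

/-! ### Decay of the generating function along spirals. -/

section Decay

variable {α : ℝ}

lemma exists_le_re_bernstein (hα0 : 0 < α) (hα1 : α < 1) {R : ℝ} (hR : 0 ≤ R) :
    ∃ η > 0, η ≤ 1 / 2 ∧ ∃ c > 0, ∀ w : ℂ, w ≠ 0 → -(η * ‖w‖) ≤ w.re → ‖w‖ ≤ R →
      c * ‖w‖ ^ α ≤ (bernstein α w).re := by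
  set A := (1 + R) ^ (-α) / (4 * α) with hA
  set M := 1 / α + 1 / (1 - α) with hM
  have h1 : 0 < 1 - α := by linarith
  have hApos : 0 < A := by positivity
  have hMpos : 0 < M := by positivity
  -- This η makes the loss 4ηM at most A/2, half of the main term.
  refine ⟨min (1 / 2) (A / (8 * M)), by positivity, min_le_left _ _, A / 2, by positivity,
    fun w hw0 hw hwR => ?_⟩
  refine le_trans ?_ (le_re_bernstein hα0 hα1 (by positivity) (min_le_left _ _) hw0 hw hwR)
  refine mul_le_mul_of_nonneg_right ?_ (by positivity)
  have h2 := mul_le_mul_of_nonneg_right (min_le_right (1 / 2) (A / (8 * M))) hMpos.le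
  have h3 : A / (8 * M) * M = A / 8 := by field_simp
  rw [← hA, ← hM]
  linarith

/-- |1-H|² = 1 - 2 Re H + |H|² ≤ 1 - 2ax + C²x² ≤ 1 - ax ≤ e^{-ax}. -/
lemma norm_one_sub_le_exp {H : ℂ} {a x C : ℝ} (hx : 0 ≤ x) (hre : a * x ≤ H.re)
    (hn : ‖H‖ ≤ C * x) (hsmall : C ^ 2 * x ≤ a) : ‖1 - H‖ ≤ Real.exp (-(a / 2 * x)) := by
  refine le_of_sq_le_sq ?_ (Real.exp_pos _).le
  have h1 : ‖1 - H‖ ^ 2 = 1 - 2 * H.re + ‖H‖ ^ 2 := by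
    rw [← Complex.normSq_eq_norm_sq, ← Complex.normSq_eq_norm_sq, Complex.normSq_apply,
      Complex.normSq_apply]
    simp only [Complex.sub_re, Complex.sub_im, Complex.one_re, Complex.one_im]
    ring
  have h2 : ‖H‖ ^ 2 ≤ (C * x) ^ 2 := pow_le_pow_left₀ (norm_nonneg _) hn 2
  have h3 := mul_le_mul_of_nonneg_right hsmall hx
  have h4 := Real.add_one_le_exp (-(a * x))
  rw [h1, ← Real.exp_nat_mul]
  have h5 : ((2 : ℕ) : ℝ) * -(a / 2 * x) = -(a * x) := by push_cast; ring
  rw [h5]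
  nlinarith

lemma continuousAt_zetaGen_spiral (hα0 : 0 < α) (hα1 : α < 1) (ε : ℝ) {θ : ℝ} (hθ0 : 0 < θ)
    (hθ1 : θ ≤ Real.pi) :
    ContinuousAt (fun p : ℝ × ℝ => zetaGen α (spiral p.1 p.2)) (ε, θ) := by
  have h1 : ContinuousAt (zetaGen α) (spiral ε θ) := by
    refine ((differentiableOn_zetaGen hα0 hα1).differentiableAt (IsOpen.mem_nhds ?_
      (one_sub_spiral_mem_slitPlane ε hθ0 hθ1))).continuousAt
    exact Complex.isOpen_slitPlane.preimage (by fun_prop : Continuous fun z : ℂ => 1 - z)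
  have h2 : ContinuousAt (fun p : ℝ × ℝ => spiral p.1 p.2) (ε, θ) := by
    unfold spiral
    fun_prop
  exact ContinuousAt.comp (f := fun p : ℝ × ℝ => spiral p.1 p.2) (g := zetaGen α) h1 h2

/-- At ε = 0 the spiral is the unit circle, where |f| < 1 away from 1. Compactness of the arc
carries the strict bound to small ε, and a maximum over a compact rectangle makes it uniform. -/
lemma exists_norm_zetaGen_spiral_le (hα0 : 0 < α) (hα1 : α < 1) {θ₀ : ℝ} (h0 : 0 < θ₀)
    (h1 : θ₀ ≤ Real.pi) :
    ∃ δ > 0, ∃ m < 1, ∀ ε ∈ Icc 0 δ, ∀ θ ∈ Icc θ₀ Real.pi, ‖zetaGen α (spiral ε θ)‖ ≤ m := by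
  have hev : ∀ᶠ ε in nhds (0 : ℝ), ∀ θ ∈ Icc θ₀ Real.pi, ‖zetaGen α (spiral ε θ)‖ < 1 := by
    refine isCompact_Icc.eventually_forall_of_forall_eventually fun θ hθ => ?_
    have hθ0 := h0.trans_le hθ.1
    refine (continuousAt_zetaGen_spiral hα0 hα1 0 hθ0 hθ.2).norm.eventually_lt
      continuousAt_const ?_
    have hn : ‖spiral 0 θ‖ = 1 := by rw [norm_spiral, zero_mul, Real.exp_zero]
    rw [zetaGen_eq_genFun hα0 hn.le]
    refine norm_genFun_zetaProb_lt_one hα0 hn fun h => ?_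
    exact Complex.slitPlane_ne_zero (one_sub_spiral_mem_slitPlane 0 hθ0 hθ.2) (by rw [h, sub_self])
  obtain ⟨δ, hδ, hball⟩ := Metric.eventually_nhds_iff.mp hev
  have hK : IsCompact (Icc 0 (δ / 2) ×ˢ Icc θ₀ Real.pi) := isCompact_Icc.prod isCompact_Icc
  have hcont : ContinuousOn (fun p : ℝ × ℝ => ‖zetaGen α (spiral p.1 p.2)‖)
      (Icc 0 (δ / 2) ×ˢ Icc θ₀ Real.pi) := fun p hp =>
    (continuousAt_zetaGen_spiral hα0 hα1 p.1 (h0.trans_le hp.2.1)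
      hp.2.2).norm.continuousWithinAt
  have hne : (Icc 0 (δ / 2) ×ˢ Icc θ₀ Real.pi).Nonempty :=
    ⟨(0, θ₀), mk_mem_prod ⟨le_rfl, by positivity⟩ ⟨le_rfl, h1⟩⟩
  obtain ⟨p, hp, hmax⟩ := hK.exists_isMaxOn hne hcont
  refine ⟨δ / 2, by positivity, ‖zetaGen α (spiral p.1 p.2)‖, hball ?_ p.2 hp.2,
    fun ε hε θ hθ => isMaxOn_iff.mp hmax (ε, θ) (mk_mem_prod hε hθ)⟩
  rw [Real.dist_eq, sub_zero, abs_of_nonneg hp.1.1]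
  linarith [hp.1.2]

/-- Along logarithmic spirals `θ ↦ e^{(ε+i)θ}` of small slope, the continued generating function
`f` satisfies `|f| ≤ e^{-c θ^α}` and `|1 - f| ≤ C θ^α`. -/
lemma exists_zetaGen_spiral_bounds (hα0 : 0 < α) (hα1 : α < 1) :
    ∃ δ > 0, δ < 1 ∧ ∃ c > 0, ∃ C > 0, ∀ ε ∈ Icc 0 δ, ∀ θ ∈ Ioc 0 Real.pi,
      ‖zetaGen α (spiral ε θ)‖ ≤ Real.exp (-(c * θ ^ α)) ∧
      ‖1 - zetaGen α (spiral ε θ)‖ ≤ C * θ ^ α := by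
  have hπ := Real.pi_pos
  set B := Real.exp Real.pi with hB
  have hBpos : 0 < B := Real.exp_pos _
  have hKpos := boseConst_pos hα0
  set K := boseConst α with hK
  obtain ⟨η, hη0, hη1, c₁, hc₁, hre⟩ := exists_le_re_bernstein hα0 hα1
    (show 0 ≤ 2 * B * Real.pi by positivity)
  set M := (1 - η)⁻¹ * (1 / α + 1 / (1 - α)) with hM
  have hMpos : 0 < M := by
    have : 0 < 1 - η := by linarith
    have : 0 < 1 - α := by linarith
    positivity
  set a := c₁ / K with ha
  set C := M / K with hC
  have hapos : 0 < a := by positivity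
  have hCpos : 0 < C := by positivity
  -- Below θ₀, the bound r ≤ 2Bθ forces C² r^α ≤ a, the smallness required by `norm_one_sub_le_exp`.
  set θ₀ := min Real.pi ((a / C ^ 2) ^ α⁻¹ / (2 * B)) with hθ₀
  have hθ₀pos : 0 < θ₀ := by positivity
  obtain ⟨δ, hδ, m, hm, hfar⟩ := exists_norm_zetaGen_spiral_le hα0 hα1 hθ₀pos (min_le_left _ _)
  -- The caps ensure, in turn, δ' < 1, the bound on the far arc, and a sector of slope at most η.
  set δ' := min (1 / 2) (min δ (η / (B * (Real.pi / 2)))) with hδ'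
  have hκ : ∀ ε ∈ Icc 0 δ', ε * B * (Real.pi / 2) ≤ η := fun ε hε => by
    have h1 : ε ≤ η / (B * (Real.pi / 2)) := hε.2.trans ((min_le_right _ _).trans (min_le_right _ _))
    rw [le_div_iff₀ (by positivity)] at h1
    linarith
  refine ⟨δ', by positivity, (min_le_left _ _).trans_lt (by norm_num),
    min (a / 2 * (2 / Real.pi) ^ α) ((1 - m) / Real.pi ^ α), ?_, C * (2 * B) ^ α, by positivity,
    fun ε hε θ hθ => ?_⟩
  · have : 0 < 1 - m := by linarith
    positivity
  have hε1 : ε ≤ 1 := hε.2.trans ((min_le_left _ _).trans (by norm_num))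
  have hw0 := Complex.slitPlane_ne_zero (one_sub_spiral_mem_slitPlane ε hθ.1 hθ.2)
  have hlow := two_div_pi_mul_le_norm_one_sub_spiral hε.1 hθ.1.le hθ.2
  have hup := norm_one_sub_spiral_le hε.1 hε1 hθ.1.le hθ.2
  have hwre : -(η * ‖1 - spiral ε θ‖) ≤ (1 - spiral ε θ).re := by
    refine le_trans ?_ (neg_mul_norm_le_re_one_sub_spiral hε.1 hε1 hθ.1.le hθ.2)
    exact neg_le_neg (mul_le_mul_of_nonneg_right (hκ ε hε) (norm_nonneg _))
  set r := ‖1 - spiral ε θ‖ with hr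
  have hθα : 0 < θ ^ α := Real.rpow_pos_of_pos hθ.1 α
  have hrlow : (2 / Real.pi) ^ α * θ ^ α ≤ r ^ α := by
    rw [← Real.mul_rpow (by positivity) hθ.1.le]
    exact Real.rpow_le_rpow (mul_nonneg (by positivity) hθ.1.le) hlow hα0.le
  have hrup : r ^ α ≤ (2 * B) ^ α * θ ^ α := by
    rw [← Real.mul_rpow (by positivity) hθ.1.le]
    exact Real.rpow_le_rpow (norm_nonneg _) hup hα0.le
  have hHn : ‖bernstein α (1 - spiral ε θ) / K‖ ≤ C * r ^ α := by
    rw [norm_div, Complex.norm_of_nonneg hKpos.le, div_le_iff₀ hKpos]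
    refine (norm_bernstein_le hα0 hα1 hη0.le (by linarith) hw0 hwre).trans (le_of_eq ?_)
    rw [← hM, ← hr, hC]
    field_simp
  have hHre : a * r ^ α ≤ (bernstein α (1 - spiral ε θ) / K).re := by
    rw [Complex.div_ofReal_re, le_div_iff₀ hKpos]
    refine (le_of_eq ?_).trans (hre _ hw0 hwre (hup.trans ?_))
    · rw [← hr, ha]
      field_simp
    · have := hθ.2
      gcongr
  refine ⟨?_, ?_⟩
  · rcases le_total θ θ₀ with h | h
    · have hsmall : C ^ 2 * r ^ α ≤ a := by
        have h1 : r ≤ (a / C ^ 2) ^ α⁻¹ := by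
          refine hup.trans ?_
          have h2 : θ ≤ (a / C ^ 2) ^ α⁻¹ / (2 * B) := h.trans (min_le_right _ _)
          rw [le_div_iff₀ (by positivity)] at h2
          linarith
        have h3 := Real.rpow_le_rpow (norm_nonneg _) h1 hα0.le
        rw [Real.rpow_inv_rpow (by positivity) hα0.ne', le_div_iff₀ (by positivity)] at h3
        linarith
      refine (norm_one_sub_le_exp (by positivity) hHre hHn hsmall).trans ?_
      refine Real.exp_le_exp.mpr (neg_le_neg ?_)
      calc _ ≤ a / 2 * (2 / Real.pi) ^ α * θ ^ α :=
            mul_le_mul_of_nonneg_right (min_le_left _ _) hθα.le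
        _ = a / 2 * ((2 / Real.pi) ^ α * θ ^ α) := by ring
        _ ≤ _ := mul_le_mul_of_nonneg_left hrlow (by positivity)
    · refine (hfar ε ⟨hε.1, hε.2.trans ((min_le_right _ _).trans (min_le_left _ _))⟩ θ
        ⟨h, hθ.2⟩).trans ?_
      -- On the far arc cθ^α ≤ 1 - m, hence m ≤ 1 - cθ^α ≤ e^{-cθ^α}.
      have h1 : min (a / 2 * (2 / Real.pi) ^ α) ((1 - m) / Real.pi ^ α) * θ ^ α ≤ 1 - m := by
        have h2 : θ ^ α ≤ Real.pi ^ α := Real.rpow_le_rpow hθ.1.le hθ.2 hα0.le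
        have h3 : 0 < 1 - m := by linarith
        calc _ ≤ (1 - m) / Real.pi ^ α * Real.pi ^ α :=
              mul_le_mul (min_le_right _ _) h2 hθα.le (by positivity)
          _ = 1 - m := by field_simp
      have h4 := Real.add_one_le_exp
        (-(min (a / 2 * (2 / Real.pi) ^ α) ((1 - m) / Real.pi ^ α) * θ ^ α))
      linarith
  · rw [zetaGen, sub_sub_cancel]
    refine hHn.trans ?_
    rw [mul_assoc]
    exact mul_le_mul_of_nonneg_left hrup hCpos.le

end Decay

/-! ### Rotation of the contour in the variable s = log z. -/

section Contour

/-- x² + (π-τ)² < τ² + (π-τ)² = π² - 2τ(π-τ) ≤ π². The disc is tangent to the real axis at 0. -/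
lemma add_mul_I_mem_ball {x τ : ℝ} (hx0 : 0 ≤ x) (hxτ : x < τ) (hτ : τ ≤ Real.pi) :
    (x : ℂ) + Complex.I * τ ∈ Metric.ball (Complex.I * Real.pi) Real.pi := by
  rw [Metric.mem_ball, Complex.dist_eq]
  refine lt_of_pow_lt_pow_left₀ 2 Real.pi_pos.le ?_
  rw [← Complex.normSq_eq_norm_sq, Complex.normSq_apply]
  simp only [Complex.sub_re, Complex.add_re, Complex.ofReal_re, Complex.mul_re, Complex.I_re,
    zero_mul, Complex.I_im, Complex.ofReal_im, mul_zero, sub_zero, add_zero, Complex.sub_im,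
    Complex.add_im, Complex.mul_im, one_mul, zero_add]
  have h1 : x * x < τ * τ := mul_self_lt_mul_self hx0 hxτ
  nlinarith [mul_le_mul_of_nonneg_left hτ (hx0.trans hxτ.le)]

lemma ray_mem_ball {a τ : ℝ} (ha0 : 0 ≤ a) (ha1 : a < 1) (hτ0 : 0 < τ) (hτ : τ ≤ Real.pi) :
    ((a : ℂ) + Complex.I) * τ ∈ Metric.ball (Complex.I * Real.pi) Real.pi := by
  have := add_mul_I_mem_ball (mul_nonneg ha0 hτ0.le) (mul_lt_of_lt_one_left hτ0 ha1) hτ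
  convert this using 1
  push_cast
  ring

variable {H : ℂ → ℂ} {ε M : ℝ}

lemma continuousOn_comp_ray
    (hH : DifferentiableOn ℂ H (Metric.ball (Complex.I * Real.pi) Real.pi)) {a : ℝ}
    (ha0 : 0 ≤ a) (ha1 : a < 1) :
    ContinuousOn (fun θ : ℝ => ((a : ℂ) + Complex.I) * H (((a : ℂ) + Complex.I) * θ))
      (Ioc 0 Real.pi) := by
  refine continuousOn_const.mul (hH.continuousOn.comp (by fun_prop) fun θ hθ => ?_)
  exact ray_mem_ball ha0 ha1 hθ.1 hθ.2

lemma norm_mul_comp_ray_le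
    (hM : ∀ a ∈ Icc 0 ε, ∀ θ ∈ Ioc 0 Real.pi, ‖H (((a : ℂ) + Complex.I) * (θ : ℝ))‖ ≤ M)
    {a : ℝ} (ha : a ∈ Icc 0 ε) (ha1 : a < 1) {θ : ℝ} (hθ : θ ∈ Ioc 0 Real.pi) :
    ‖((a : ℂ) + Complex.I) * H (((a : ℂ) + Complex.I) * θ)‖ ≤ 2 * M := by
  rw [norm_mul]
  refine mul_le_mul ?_ (hM a ha θ hθ) (norm_nonneg _) zero_le_two
  refine (norm_add_le _ _).trans ?_
  rw [Complex.norm_of_nonneg ha.1, Complex.norm_I]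
  linarith

lemma intervalIntegrable_comp_ray
    (hH : DifferentiableOn ℂ H (Metric.ball (Complex.I * Real.pi) Real.pi))
    (hM : ∀ a ∈ Icc 0 ε, ∀ θ ∈ Ioc 0 Real.pi, ‖H (((a : ℂ) + Complex.I) * (θ : ℝ))‖ ≤ M)
    {a : ℝ} (ha : a ∈ Icc 0 ε) (ha1 : a < 1) :
    IntervalIntegrable (fun θ : ℝ => ((a : ℂ) + Complex.I) * H (((a : ℂ) + Complex.I) * θ))
      volume 0 Real.pi := by
  rw [intervalIntegrable_iff_integrableOn_Ioc_of_le Real.pi_pos.le]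
  refine IntegrableOn.of_bound (by simp)
    ((continuousOn_comp_ray hH ha.1 ha1).aestronglyMeasurable measurableSet_Ioc) (2 * M) ?_
  exact (ae_restrict_iff' measurableSet_Ioc).mpr
    (.of_forall fun θ hθ => norm_mul_comp_ray_le hM ha ha1 hθ)

/-- Rotating a ray issuing from `0`: for `H` holomorphic on the disk of centre `iπ` and radius `π`,
bounded near `0` in a sector and real on the line `Im s = π`, the imaginary part of the integral of
`H` along the ray up to that line does not depend on the ray. -/
lemma im_integral_ray_eq
    (hH : DifferentiableOn ℂ H (Metric.ball (Complex.I * Real.pi) Real.pi)) (hε0 : 0 ≤ ε)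
    (hε1 : ε < 1)
    (hM : ∀ a ∈ Icc 0 ε, ∀ θ ∈ Ioc 0 Real.pi, ‖H (((a : ℂ) + Complex.I) * (θ : ℝ))‖ ≤ M)
    (hreal : ∀ x : ℝ, (H (x + Complex.I * Real.pi)).im = 0) :
    (∫ θ in (0 : ℝ)..Real.pi, Complex.I * H (Complex.I * θ)).im =
      (∫ θ in (0 : ℝ)..Real.pi, ((ε : ℂ) + Complex.I) * H (((ε : ℂ) + Complex.I) * θ)).im := by
  have hπ := Real.pi_pos
  -- The origin is only a boundary point of the disc, so the primitive is used above height τ, and τ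
  -- tends to 0 at the end.
  obtain ⟨P, hP⟩ := hH.isExactOn_ball
  set J : ℝ → ℝ → ℂ := fun a θ => ((a : ℂ) + Complex.I) * H (((a : ℂ) + Complex.I) * θ) with hJ
  have hint : ∀ a ∈ Icc 0 ε, IntervalIntegrable (J a) volume 0 Real.pi := fun a ha =>
    intervalIntegrable_comp_ray hH hM ha (ha.2.trans_lt hε1)
  have hbound : ∀ a ∈ Icc 0 ε, ∀ τ ∈ Ioc 0 Real.pi, ‖∫ θ in (0 : ℝ)..τ, J a θ‖ ≤ 2 * M * τ := by
    intro a ha τ hτ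
    have := intervalIntegral.norm_integral_le_of_norm_le_const (a := 0) (b := τ) (f := J a)
      (C := 2 * M) fun θ hθ => by
        rw [uIoc_of_le hτ.1.le] at hθ
        exact norm_mul_comp_ray_le hM ha (ha.2.trans_lt hε1) ⟨hθ.1, hθ.2.trans hτ.2⟩
    rwa [sub_zero, abs_of_pos hτ.1] at this
  have hray : ∀ a ∈ Icc 0 ε, ∀ τ ∈ Ioc 0 Real.pi, ∫ θ in τ..Real.pi, J a θ =
      P (((a : ℂ) + Complex.I) * Real.pi) - P (((a : ℂ) + Complex.I) * τ) := by
    intro a ha τ hτ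
    have hsub : uIcc τ Real.pi ⊆ Ioc 0 Real.pi := by
      rw [uIcc_of_le hτ.2]
      exact fun θ hθ => ⟨hτ.1.trans_le hθ.1, hθ.2⟩
    refine intervalIntegral.integral_eq_sub_of_hasDerivAt
      (f := fun θ : ℝ => P (((a : ℂ) + Complex.I) * θ)) (fun θ hθ => ?_) ?_
    · have hθ' := hsub hθ
      have h1 : HasDerivAt (fun θ : ℝ => ((a : ℂ) + Complex.I) * (θ : ℂ))
          (((a : ℂ) + Complex.I) * 1) θ :=
        (Complex.ofRealCLM.hasDerivAt (x := θ)).const_mul _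
      have h2 := (hP _ (ray_mem_ball ha.1 (ha.2.trans_lt hε1) hθ'.1 hθ'.2)).comp θ h1
      refine h2.congr_deriv ?_
      simp only [hJ]
      ring
    · exact ((continuousOn_comp_ray hH ha.1 (ha.2.trans_lt hε1)).mono hsub).intervalIntegrable
  have hhor : ∀ τ ∈ Ioc 0 Real.pi, P (((ε : ℂ) + Complex.I) * τ) - P (Complex.I * τ) =
      ∫ x in (0 : ℝ)..ε * τ, H (x + Complex.I * τ) := by
    intro τ hτ
    have hετ : 0 ≤ ε * τ := mul_nonneg hε0 hτ.1.le
    have hmem : ∀ x ∈ uIcc 0 (ε * τ), (x : ℂ) + Complex.I * τ ∈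
        Metric.ball (Complex.I * Real.pi) Real.pi := by
      intro x hx
      rw [uIcc_of_le hετ] at hx
      exact add_mul_I_mem_ball hx.1 (hx.2.trans_lt (mul_lt_of_lt_one_left hτ.1 hε1)) hτ.2
    have hFTC := intervalIntegral.integral_eq_sub_of_hasDerivAt (a := 0) (b := ε * τ)
      (f := fun x : ℝ => P ((x : ℂ) + Complex.I * τ)) (f' := fun x => H (x + Complex.I * τ))
      (fun x hx => ?_) ?_
    · rw [hFTC]
      push_cast
      rw [zero_add]
      ring_nf
    · have h1 : HasDerivAt (fun x : ℝ => (x : ℂ) + Complex.I * τ) 1 x :=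
        (Complex.ofRealCLM.hasDerivAt (x := x)).add_const _
      have h2 := (hP _ (hmem x hx)).comp x h1
      rw [mul_one] at h2
      exact h2
    · exact (hH.continuousOn.comp (by fun_prop) hmem).intervalIntegrable
  have hhorim : (P (((ε : ℂ) + Complex.I) * Real.pi) - P (Complex.I * Real.pi)).im = 0 := by
    rw [hhor Real.pi ⟨hπ, le_rfl⟩]
    have hε' : ∀ x : ℝ, H (x + Complex.I * Real.pi) = ((H (x + Complex.I * Real.pi)).re : ℂ) :=
      fun x => Complex.ext rfl (by simp [hreal x])
    rw [intervalIntegral.integral_congr fun x _ => hε' x, intervalIntegral.integral_ofReal,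
      Complex.ofReal_im]
  have hhorb : ∀ τ ∈ Ioc 0 Real.pi,
      ‖P (((ε : ℂ) + Complex.I) * τ) - P (Complex.I * τ)‖ ≤ M * τ := by
    intro τ hτ
    have hετ : 0 ≤ ε * τ := mul_nonneg hε0 hτ.1.le
    have hM0 : 0 ≤ M := (norm_nonneg _).trans (hM 0 ⟨le_rfl, hε0⟩ τ hτ)
    rw [hhor τ hτ]
    refine (intervalIntegral.norm_integral_le_of_norm_le_const (C := M) fun x hx => ?_).trans ?_
    · rw [uIoc_of_le hετ] at hx
      have h := hM (x / τ) ⟨div_nonneg hx.1.le hτ.1.le, (div_le_iff₀ hτ.1).mpr hx.2⟩ τ hτ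
      have hτ0 : (τ : ℂ) ≠ 0 := by exact_mod_cast hτ.1.ne'
      have e : (((x / τ : ℝ) : ℂ) + Complex.I) * τ = x + Complex.I * τ := by
        push_cast
        field_simp
      rwa [e] at h
    · rw [sub_zero, abs_of_nonneg hετ]
      exact mul_le_mul_of_nonneg_left (mul_le_of_le_one_left hτ.1.le hε1.le) hM0
  have h0 : (0 : ℝ) ∈ Icc 0 ε := ⟨le_rfl, hε0⟩
  have hεm : ε ∈ Icc 0 ε := ⟨hε0, le_rfl⟩
  have hJ0 : ∫ θ in (0 : ℝ)..Real.pi, Complex.I * H (Complex.I * θ) = ∫ θ in (0 : ℝ)..Real.pi, J 0 θ := by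
    simp [hJ]
  rw [hJ0]
  change _ = (∫ θ in (0 : ℝ)..Real.pi, J ε θ).im
  -- Two initial ray pieces of size 2Mτ each and a horizontal segment of size Mτ; the top segment
  -- has no imaginary part.
  have key : ∀ τ ∈ Ioc 0 Real.pi,
      |(∫ θ in (0 : ℝ)..Real.pi, J ε θ).im - (∫ θ in (0 : ℝ)..Real.pi, J 0 θ).im| ≤ 5 * M * τ := by
    intro τ hτ
    have hsplit : ∀ a ∈ Icc 0 ε, ∫ θ in (0 : ℝ)..Real.pi, J a θ = (∫ θ in (0 : ℝ)..τ, J a θ) +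
        (P (((a : ℂ) + Complex.I) * Real.pi) - P (((a : ℂ) + Complex.I) * τ)) := by
      intro a ha
      have hsub1 : uIcc 0 τ ⊆ uIcc 0 Real.pi := by
        rw [uIcc_of_le hτ.1.le, uIcc_of_le hπ.le]
        exact Icc_subset_Icc_right hτ.2
      have hsub2 : uIcc τ Real.pi ⊆ uIcc 0 Real.pi := by
        rw [uIcc_of_le hτ.2, uIcc_of_le hπ.le]
        exact Icc_subset_Icc_left hτ.1.le
      rw [← hray a ha τ hτ, intervalIntegral.integral_add_adjacent_intervals
        ((hint a ha).mono_set hsub1) ((hint a ha).mono_set hsub2)]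
    rw [hsplit ε hεm, hsplit 0 h0, ← Complex.sub_im, Complex.ofReal_zero, zero_add]
    have e : (∫ θ in (0 : ℝ)..τ, J ε θ) + (P (((ε : ℂ) + Complex.I) * Real.pi) -
          P (((ε : ℂ) + Complex.I) * τ)) - ((∫ θ in (0 : ℝ)..τ, J 0 θ) +
          (P (Complex.I * Real.pi) - P (Complex.I * τ))) =
        (P (((ε : ℂ) + Complex.I) * Real.pi) - P (Complex.I * Real.pi)) +
        ((∫ θ in (0 : ℝ)..τ, J ε θ) - (∫ θ in (0 : ℝ)..τ, J 0 θ) -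
          (P (((ε : ℂ) + Complex.I) * τ) - P (Complex.I * τ))) := by ring
    rw [e, Complex.add_im, hhorim, zero_add]
    refine (Complex.abs_im_le_norm _).trans ((norm_sub_le _ _).trans ?_)
    have h1 := norm_sub_le (∫ θ in (0 : ℝ)..τ, J ε θ) (∫ θ in (0 : ℝ)..τ, J 0 θ)
    have h2 := hbound ε hεm τ hτ
    have h3 := hbound 0 h0 τ hτ
    have h4 := hhorb τ hτ
    linarith
  have hlim : Filter.Tendsto (fun τ : ℝ => 5 * M * τ) (nhdsWithin 0 (Ioi 0)) (nhds 0) := by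
    have : Filter.Tendsto (fun τ : ℝ => 5 * M * τ) (nhds 0) (nhds (5 * M * 0)) :=
      (continuous_const.mul continuous_id).tendsto 0
    rw [mul_zero] at this
    exact this.mono_left nhdsWithin_le_nhds
  have hle := ge_of_tendsto hlim (Filter.mem_of_superset (Ioc_mem_nhdsGT hπ) key)
  exact (sub_eq_zero.mp (abs_nonpos_iff.mp hle)).symm

end Contour

/-! ### Coefficients as half-circle integrals. -/

section Coefficients

lemma integral_cos_int_mul (m : ℤ) (hm : m ≠ 0) :
    ∫ θ in (0 : ℝ)..Real.pi, Real.cos (m * θ) = 0 := by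
  have hm' : (m : ℝ) ≠ 0 := by exact_mod_cast hm
  rw [intervalIntegral.integral_comp_mul_left _ hm', integral_cos, Real.sin_int_mul_pi]
  simp

/-- The factor i turns the real part into an imaginary part. For real F only the cosines cos((j-k)θ)
survive, and those with j ≠ k integrate to 0 over [0, π]. -/
lemma pi_mul_re_eq_im_integral {F : ℤ → ℂ} (hF : F ∈ L1Z) (him : ∀ k, (F k).im = 0) (k : ℕ) :
    Real.pi * (F k).re = (∫ θ in (0 : ℝ)..Real.pi, Complex.I *
      (genFun F (Complex.exp (Complex.I * θ)) * Complex.exp (-(k * (Complex.I * θ))))).im := by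
  have hπ := Real.pi_pos
  set u : ℕ → ℝ → ℂ := fun j θ =>
    Complex.I * (F j * Complex.exp ((((j : ℤ) - (k : ℤ) : ℤ) * θ : ℝ) * Complex.I)) with hu
  have hun : ∀ j θ, ‖u j θ‖ = ‖F j‖ := fun j θ => by
    rw [hu]
    simp only
    rw [norm_mul, norm_mul, Complex.norm_exp_ofReal_mul_I, Complex.norm_I, one_mul, mul_one]
  have hcont : ∀ j, Continuous (u j) := fun j => by
    rw [hu]
    fun_prop
  have hsum := summable_norm_natCast hF
  have h := hasSum_integral_of_summable_integral_norm (μ := volume.restrict (Ioc 0 Real.pi))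
    (F := u) (fun j => (hcont j).integrableOn_Ioc) (by
      simp_rw [hun, integral_const, smul_eq_mul]
      exact hsum.mul_left _)
  have hval : ∀ θ : ℝ, ∑' j, u j θ = Complex.I * (genFun F (Complex.exp (Complex.I * θ)) *
      Complex.exp (-(k * (Complex.I * θ)))) := fun θ => by
    rw [hu]
    simp only
    rw [tsum_mul_left, genFun, ← tsum_mul_right]
    congr 1
    refine tsum_congr fun j => ?_
    rw [smul_eq_mul, mul_assoc, ← Complex.exp_nat_mul, ← Complex.exp_add]
    congr 2
    push_cast
    ring
  simp_rw [hval] at h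
  have hre : ∀ j, (∫ θ in Ioc (0 : ℝ) Real.pi, u j θ).im = if j = k then Real.pi * (F k).re else 0 := by
    intro j
    rw [← intervalIntegral.integral_of_le hπ.le]
    have h1 : (∫ θ in (0 : ℝ)..Real.pi, u j θ).im =
        ∫ θ in (0 : ℝ)..Real.pi, (F j).re * Real.cos (((j : ℤ) - (k : ℤ) : ℤ) * θ) := by
      have h2 := Complex.imCLM.intervalIntegral_comp_comm
        ((hcont j).intervalIntegrable (μ := volume) 0 Real.pi)
      rw [← Complex.imCLM_apply, ← h2]
      refine intervalIntegral.integral_congr fun θ _ => ?_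
      simp only [hu, Complex.imCLM_apply, Complex.I_mul_im, Complex.mul_re,
        Complex.exp_ofReal_mul_I_re, him, zero_mul, sub_zero]
    rw [h1, intervalIntegral.integral_const_mul]
    split_ifs with hjk
    · subst hjk
      simp [mul_comm]
    · rw [integral_cos_int_mul _ (by omega), mul_zero]
  have h3 := Complex.hasSum_im h
  simp_rw [hre] at h3
  rw [intervalIntegral.integral_of_le hπ.le]
  exact (hasSum_ite_eq k _).unique h3

end Coefficients

/-! ### The L¹ estimate and membership in 𝒜. -/

section Main

variable {α : ℝ}

/-- The integrand, in the variable `s = log z`, whose integral gives the `k`-th Taylor coefficient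
of `fⁿ (1 - f)`, `f` being the continued generating function. -/
noncomputable def coeffIntegrand (α : ℝ) (n k : ℕ) (s : ℂ) : ℂ :=
  zetaGen α (Complex.exp s) ^ n * (1 - zetaGen α (Complex.exp s)) * Complex.exp (-(k * s))

lemma differentiableOn_coeffIntegrand (hα0 : 0 < α) (hα1 : α < 1) (n k : ℕ) :
    DifferentiableOn ℂ (coeffIntegrand α n k) (Metric.ball (Complex.I * Real.pi) Real.pi) := by
  have h : DifferentiableOn ℂ (fun s => zetaGen α (Complex.exp s))
      (Metric.ball (Complex.I * Real.pi) Real.pi) := by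
    refine (differentiableOn_zetaGen hα0 hα1).comp Complex.differentiable_exp.differentiableOn
      fun s hs => ?_
    rw [Metric.mem_ball, Complex.dist_eq] at hs
    have h1 := (Complex.abs_im_le_norm (s - Complex.I * Real.pi)).trans_lt hs
    rw [Complex.sub_im, Complex.I_mul_im, Complex.ofReal_re, abs_lt] at h1
    exact one_sub_exp_mem_slitPlane (by linarith) (by linarith)
  unfold coeffIntegrand
  exact ((h.pow n).mul (h.const_sub 1)).mul (by fun_prop)

/-- On Im s = π the point e^s is a negative real, where the continuation is real. -/
lemma coeffIntegrand_im (α : ℝ) (n k : ℕ) (x : ℝ) :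
    (coeffIntegrand α n k (x + Complex.I * Real.pi)).im = 0 := by
  have h1 : Complex.exp (x + Complex.I * Real.pi) = ((-Real.exp x : ℝ) : ℂ) := by
    rw [Complex.exp_add, mul_comm Complex.I, Complex.exp_pi_mul_I]
    push_cast
    ring
  have h2 : Complex.exp (-(k * (x + Complex.I * Real.pi))) = (((-Real.exp x) ^ k)⁻¹ : ℝ) := by
    rw [Complex.exp_neg, Complex.exp_nat_mul, h1]
    push_cast
    rfl
  have h3 : zetaGen α ((-Real.exp x : ℝ) : ℂ) = ((zetaGen α ((-Real.exp x : ℝ) : ℂ)).re : ℂ) :=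
    Complex.ext rfl (by rw [zetaGen_ofReal_im, Complex.ofReal_im])
  rw [coeffIntegrand, h2, h1, h3]
  norm_cast

lemma norm_coeffIntegrand_spiral_le {c C ε θ : ℝ} (n k : ℕ)
    (h1 : ‖zetaGen α (spiral ε θ)‖ ≤ Real.exp (-(c * θ ^ α)))
    (h2 : ‖1 - zetaGen α (spiral ε θ)‖ ≤ C * θ ^ α) :
    ‖coeffIntegrand α n k (((ε : ℂ) + Complex.I) * θ)‖ ≤
      C * θ ^ α * Real.exp (-(n * c * θ ^ α)) * Real.exp (-(k * (ε * θ))) := by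
  have h3 : ‖Complex.exp (-(k * (((ε : ℂ) + Complex.I) * θ)))‖ = Real.exp (-(k * (ε * θ))) := by
    rw [Complex.norm_exp]
    simp
  rw [coeffIntegrand, norm_mul, norm_mul, norm_pow, h3]
  refine mul_le_mul_of_nonneg_right ?_ (Real.exp_pos _).le
  rw [mul_comm (C * _)]
  refine mul_le_mul ?_ h2 (norm_nonneg _) (Real.exp_pos _).le
  refine (pow_le_pow_left₀ (norm_nonneg _) h1 n).trans (le_of_eq ?_)
  rw [← Real.exp_nat_mul]
  ring_nf

lemma re_coeff_eq (hα : 0 < α) (n k : ℕ) :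
    Real.pi * ((convPow (zetaProb α) n - convPow (zetaProb α) (n + 1)) k).re =
      (∫ θ in (0 : ℝ)..Real.pi, Complex.I * coeffIntegrand α n k (Complex.I * θ)).im := by
  have hF := (zetaProb_mem hα).2
  rw [pi_mul_re_eq_im_integral (sub_mem (convPow_mem hF n) (convPow_mem hF (n + 1))).1
    fun j => by
      rw [Pi.sub_apply, Complex.sub_im, convPow_im (zetaProb_im hα), convPow_im (zetaProb_im hα),
        sub_zero]]
  congr 1
  refine intervalIntegral.integral_congr fun θ _ => ?_
  have hz : ‖Complex.exp (Complex.I * θ)‖ ≤ 1 := by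
    rw [mul_comm, Complex.norm_exp_ofReal_mul_I]
  rw [coeffIntegrand, genFun_sub (convPow_mem hF n) (convPow_mem hF (n + 1)) (norm_pow_le_one hz),
    genFun_convPow hF (norm_pow_le_one hz), genFun_convPow hF (norm_pow_le_one hz),
    zetaGen_eq_genFun hα hz]
  ring

/-- With q = e^{-x}, e^x ≥ 1 + x gives xq ≤ 1 - q, and (1-q) ∑ q^k telescopes. -/
lemma mul_sum_exp_neg_le_one (x : ℝ) (N : ℕ) :
    x * ∑ k ∈ Finset.range N, Real.exp (-(((k + 1 : ℕ) : ℝ) * x)) ≤ 1 := by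
  set q := Real.exp (-x) with hq
  have hqpos : 0 < q := Real.exp_pos _
  have hterm : ∀ k : ℕ, Real.exp (-(((k + 1 : ℕ) : ℝ) * x)) = q * q ^ k := fun k => by
    rw [← pow_succ', hq, ← Real.exp_nat_mul, mul_neg]
  simp_rw [hterm]
  rw [← Finset.mul_sum, ← mul_assoc]
  have h1 : x * q ≤ 1 - q := by
    have h2 : Real.exp x * q = 1 := by rw [hq, ← Real.exp_add]; simp
    nlinarith [mul_le_mul_of_nonneg_right (Real.add_one_le_exp x) hqpos.le]
  have h3 : 0 ≤ ∑ k ∈ Finset.range N, q ^ k := Finset.sum_nonneg fun k _ => by positivity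
  refine (mul_le_mul_of_nonneg_right h1 h3).trans ?_
  rw [mul_neg_geom_sum]
  linarith [pow_pos hqpos N]

lemma intervalIntegrable_rpow_mul_exp (hα : 0 < α) (b : ℝ) :
    IntervalIntegrable (fun θ : ℝ => θ ^ (α - 1) * Real.exp (-(b * θ ^ α))) volume 0 Real.pi := by
  refine (intervalIntegral.intervalIntegrable_rpow' (by linarith)).mul_continuousOn ?_
  have : Continuous fun θ : ℝ => θ ^ α := Real.continuous_rpow_const hα.le
  fun_prop

/-- The integrand has the primitive -e^{-bθ^α}/(bα). Taking b = nc produces the factor 1/n. -/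
lemma integral_rpow_mul_exp_le (hα : 0 < α) {b : ℝ} (hb : 0 < b) :
    ∫ θ in (0 : ℝ)..Real.pi, θ ^ (α - 1) * Real.exp (-(b * θ ^ α)) ≤ 1 / (b * α) := by
  have hc : Continuous fun θ : ℝ => θ ^ α := Real.continuous_rpow_const hα.le
  have h := intervalIntegral.integral_eq_sub_of_hasDerivAt_of_le Real.pi_pos.le
    (f := fun θ : ℝ => -(1 / (b * α)) * Real.exp (-(b * θ ^ α)))
    (f' := fun θ : ℝ => θ ^ (α - 1) * Real.exp (-(b * θ ^ α))) (by fun_prop)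
    (fun θ hθ => by
      have h1 := (((Real.hasDerivAt_rpow_const (p := α) (Or.inl hθ.1.ne')).const_mul
        b).neg.exp).const_mul (-(1 / (b * α)))
      refine h1.congr_deriv ?_
      simp only [Pi.neg_apply]
      field_simp) (intervalIntegrable_rpow_mul_exp hα b)
  rw [h, Real.zero_rpow hα.ne', mul_zero, neg_zero, Real.exp_zero]
  have : 0 ≤ 1 / (b * α) * Real.exp (-(b * Real.pi ^ α)) := by positivity
  linarith

lemma exists_sum_norm_coeff_le (hα0 : 0 < α) (hα1 : α < 1) :
    ∃ D : ℝ, ∀ n : ℕ, 1 ≤ n → ∀ N : ℕ, (n : ℝ) * ∑ k ∈ Finset.range N,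
      ‖(convPow (zetaProb α) n - convPow (zetaProb α) (n + 1)) ((k + 1 : ℕ) : ℤ)‖ ≤ D := by
  have hπ := Real.pi_pos
  obtain ⟨ε, hε0, hε1, c, hc, C, hC, hb⟩ := exists_zetaGen_spiral_bounds hα0 hα1
  -- The 2 bounds |ε + i|, π comes from the coefficient formula, ε from the geometric sum, cα from
  -- the last integral.
  refine ⟨2 * C / (Real.pi * ε * c * α), fun n hn N => ?_⟩
  have hn0 : (0 : ℝ) < n := by exact_mod_cast hn
  have hεm : ε ∈ Icc 0 ε := ⟨hε0.le, le_rfl⟩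
  set a := convPow (zetaProb α) n - convPow (zetaProb α) (n + 1) with ha
  set g : ℕ → ℝ → ℝ := fun k θ =>
    2 * (C * θ ^ α * Real.exp (-(n * c * θ ^ α)) * Real.exp (-(k * (ε * θ)))) with hg
  have hcα : Continuous fun θ : ℝ => θ ^ α := Real.continuous_rpow_const hα0.le
  have hgc : ∀ k, Continuous (g k) := fun k => by
    rw [hg]
    fun_prop
  have hM : ∀ k : ℕ, ∀ e ∈ Icc 0 ε, ∀ θ ∈ Ioc 0 Real.pi,
      ‖coeffIntegrand α n k (((e : ℂ) + Complex.I) * (θ : ℝ))‖ ≤ C * Real.pi ^ α := by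
    intro k e he θ hθ
    have hθ0 := hθ.1.le
    refine (norm_coeffIntegrand_spiral_le n k (hb e he θ hθ).1 (hb e he θ hθ).2).trans ?_
    have h1 : Real.exp (-(n * c * θ ^ α)) ≤ 1 := Real.exp_le_one_iff.mpr (by
      have : 0 ≤ n * c * θ ^ α := by positivity
      linarith)
    have h2 : Real.exp (-(k * (e * θ))) ≤ 1 := Real.exp_le_one_iff.mpr (by
      have := he.1
      have : 0 ≤ k * (e * θ) := by positivity
      linarith)
    have h3 : θ ^ α ≤ Real.pi ^ α := Real.rpow_le_rpow hθ0 hθ.2 hα0.le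
    calc _ ≤ C * Real.pi ^ α * 1 * 1 := by gcongr
      _ = _ := by ring
  have hcoeff : ∀ k : ℕ, Real.pi * ‖a (k : ℤ)‖ ≤ ∫ θ in (0 : ℝ)..Real.pi, g k θ := by
    intro k
    have him : (a k).im = 0 := by
      rw [ha, Pi.sub_apply, Complex.sub_im, convPow_im (zetaProb_im hα0),
        convPow_im (zetaProb_im hα0), sub_zero]
    have hn1 : ‖a (k : ℤ)‖ = |(a k).re| := by
      rw [← Real.norm_eq_abs, ← Complex.norm_real]
      congr 1
      exact Complex.ext rfl him
    have h1 := re_coeff_eq hα0 n k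
    rw [im_integral_ray_eq (differentiableOn_coeffIntegrand hα0 hα1 n k) hε0.le hε1 (hM k)
      (coeffIntegrand_im α n k)] at h1
    rw [hn1, ← abs_of_pos hπ, ← abs_mul, abs_of_pos hπ, h1]
    refine (Complex.abs_im_le_norm _).trans ?_
    refine intervalIntegral.norm_integral_le_of_norm_le hπ.le (.of_forall fun θ hθ => ?_)
      ((hgc k).intervalIntegrable _ _)
    rw [norm_mul]
    refine mul_le_mul ?_ (norm_coeffIntegrand_spiral_le n k (hb ε hεm θ hθ).1 (hb ε hεm θ hθ).2)
      (norm_nonneg _) zero_le_two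
    refine (norm_add_le _ _).trans ?_
    rw [Complex.norm_of_nonneg hε0.le, Complex.norm_I]
    linarith
  have hsum : Real.pi * ∑ k ∈ Finset.range N, ‖a ((k + 1 : ℕ) : ℤ)‖ ≤
      2 * C / ε * (1 / (n * c * α)) := by
    calc Real.pi * ∑ k ∈ Finset.range N, ‖a ((k + 1 : ℕ) : ℤ)‖
        ≤ ∑ k ∈ Finset.range N, ∫ θ in (0 : ℝ)..Real.pi, g (k + 1) θ := by
          rw [Finset.mul_sum]
          exact Finset.sum_le_sum fun k _ => hcoeff (k + 1)
      _ = ∫ θ in (0 : ℝ)..Real.pi, ∑ k ∈ Finset.range N, g (k + 1) θ :=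
          (intervalIntegral.integral_finsetSum fun k _ =>
            (hgc (k + 1)).intervalIntegrable _ _).symm
      _ ≤ ∫ θ in (0 : ℝ)..Real.pi,
            2 * C / ε * (θ ^ (α - 1) * Real.exp (-(n * c * θ ^ α))) := by
          refine intervalIntegral.integral_mono_on_of_le_Ioo hπ.le
            ((continuous_finsetSum _ fun k _ => hgc (k + 1)).intervalIntegrable _ _)
            ((intervalIntegrable_rpow_mul_exp hα0 _).const_mul _) fun θ hθ => ?_
          have hθ0 := hθ.1
          have h1 := mul_sum_exp_neg_le_one (ε * θ) N
          have h2 : ∑ k ∈ Finset.range N, g (k + 1) θ =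
              2 * C / ε * (θ ^ (α - 1) * Real.exp (-(n * c * θ ^ α))) * (ε * θ *
                ∑ k ∈ Finset.range N, Real.exp (-(((k + 1 : ℕ) : ℝ) * (ε * θ)))) := by
            simp only [hg]
            rw [← Finset.mul_sum, ← Finset.mul_sum, Real.rpow_sub_one hθ0.ne']
            generalize ∑ k ∈ Finset.range N, Real.exp (-(((k + 1 : ℕ) : ℝ) * (ε * θ))) = S
            field_simp
          rw [h2]
          exact mul_le_of_le_one_right (by positivity) h1
      _ ≤ 2 * C / ε * (1 / (n * c * α)) := by
          rw [intervalIntegral.integral_const_mul]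
          exact mul_le_mul_of_nonneg_left (integral_rpow_mul_exp_le hα0 (by positivity))
            (by positivity)
  have h4 := mul_le_mul_of_nonneg_left hsum (show 0 ≤ n / Real.pi by positivity)
  have h5 : n / Real.pi * (2 * C / ε * (1 / (n * c * α))) = 2 * C / (Real.pi * ε * c * α) := by
    field_simp
  have h6 : n / Real.pi * (Real.pi * ∑ k ∈ Finset.range N, ‖a ((k + 1 : ℕ) : ℤ)‖) =
      n * ∑ k ∈ Finset.range N, ‖a ((k + 1 : ℕ) : ℤ)‖ := by
    field_simp
  linarith

lemma zetaProb_mem_classA (hα0 : 0 < α) (hα1 : α < 1) : zetaProb α ∈ classA := by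
  refine ⟨zetaProb_mem hα0, ?_⟩
  obtain ⟨D, hD⟩ := exists_sum_norm_coeff_le hα0 hα1
  have hF := (zetaProb_mem hα0).2
  refine lt_of_le_of_lt (iSup₂_le fun n hn => ?_) (ENNReal.ofReal_lt_top (r := D))
  set a := convPow (zetaProb α) n - convPow (zetaProb α) (n + 1) with ha
  -- The estimate covers k ≥ 1 only; here n ≥ 1 matters, since δ_0 does not vanish at 0.
  have ha0 : a 0 = 0 := by
    rw [ha, Pi.sub_apply, convPow_apply_zero hF (zetaProb_of_le_zero le_rfl) hn,
      convPow_apply_zero hF (zetaProb_of_le_zero le_rfl) (by omega), sub_zero]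
  have ham := sub_mem (convPow_mem hF n) (convPow_mem hF (n + 1))
  rw [l1Norm_eq_tsum_natCast ham, ← ha, ← ENNReal.tsum_mul_left]
  refine ENNReal.tsum_le_of_sum_range_le fun N => ?_
  calc ∑ k ∈ Finset.range N, (n : ℝ≥0∞) * ‖a (k : ℤ)‖ₑ
      ≤ ∑ k ∈ Finset.range (N + 1), (n : ℝ≥0∞) * ‖a (k : ℤ)‖ₑ :=
        Finset.sum_le_sum_of_subset (Finset.range_mono (Nat.le_succ N))
    _ = ∑ k ∈ Finset.range N, (n : ℝ≥0∞) * ‖a ((k + 1 : ℕ) : ℤ)‖ₑ := by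
        rw [Finset.sum_range_succ', Nat.cast_zero, ha0, enorm_zero, mul_zero, add_zero]
    _ = ENNReal.ofReal ((n : ℝ) * ∑ k ∈ Finset.range N, ‖a ((k + 1 : ℕ) : ℤ)‖) := by
        rw [ENNReal.ofReal_mul n.cast_nonneg, ENNReal.ofReal_natCast,
          ENNReal.ofReal_sum_of_nonneg fun _ _ => norm_nonneg _, Finset.mul_sum]
        simp_rw [ofReal_norm]
    _ ≤ ENNReal.ofReal D := ENNReal.ofReal_le_ofReal (hD n hn N)

end Main

end RittProb

theorem theorem1p2 (α : ℝ) (hα0 : 0 < α) (hα1 : α < 1) :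
    RittProb.zetaProb α ∈ RittProb.classA ∧
    ∀ (X : Type*) [NormedAddCommGroup X] [NormedSpace ℂ X] [CompleteSpace X] (T : X →L[ℂ] X),
      RittProb.IsPowerBounded T →
        Summable (fun k : ℕ => ‖RittProb.zetaProb α (k : ℤ) • T ^ k‖) ∧
        RittProb.IsRitt (RittProb.Psi (RittProb.zetaProb α) T) := by
  refine ⟨RittProb.zetaProb_mem_classA hα0 hα1, fun X _ _ _ T hT => ⟨?_, ?_⟩⟩
  · obtain ⟨C, hC⟩ := hT.exists_forall_norm_pow_le
    exact RittProb.summable_norm_genFun (RittProb.zetaProb_mem hα0).2.1 hC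
  · exact RittProb.isRitt_Psi (RittProb.zetaProb_mem_classA hα0 hα1)
      (RittProb.l1Norm_zetaProb hα0).le hT
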